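/- Let $\Sigma=\{0,1\}$ and $\mathcal B=(\Sigma^*)^{\Sigma^*}$. For $\varphi\in\mathcal B$ let $|\varphi|\colon\mathbb N\to\mathbb N$, $|\varphi|(n)=\max\{|\varphi(a)| : |a|\le n\}$. An oracle Turing machine $M$ is a deterministic multi-tape Turing machine with one-sided tapes: an input tape, an output tape, an oracle query tape and finitely many work tapes, over a finite tape alphabet containing $\Sigma$ and a blank. It starts with the input on the input tape, all other tapes blank, and all heads on the first cells. The string on the query or output tape is the longest word over $\Sigma$ that starts in the first cell and consists of cells strictly to the left of the head. When $M$ with oracle $\varphi$ is in its query state, the string $b$ on the query tape is in one time step replaced by $\varphi(b)$ (so that the tape holds $\varphi(b)$ followed by blanks), no head moves, and the computation continues in a fixed state. $M$ computes a functional $F\colon\mathcal B\to\mathcal B$ if for all $\varphi\in\mathcal B$, $a\in\Sigma^*$ the run of $M$ with oracle $\varphi$ on input $a$ terminates with $F(\varphi)(a)$ as the string on the output tape. A function $T\colon\mathbb N^{\mathbb N}\times\mathbb N\to\mathbb N$ is a running time if for all monotone $l,l'$ with $l'\le l$ pointwise, $T(l,\cdot)$ and $T(l',\cdot)$ are monotone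 and $T(l',\cdot)\le T(l,\cdot)$ pointwise. It is a running time for $M$ if, moreover, for all $\varphi\in\mathcal B$, $a\in\Sigma^*$ the run of $M$ with oracle $\varphi$ on input $a$ terminates within $T(|\varphi|,|a|)$ steps. A functional can be computed in time $T$ if some oracle Turing machine computes it and has $T$ as a running time. The second-order polynomials form the smallest class of functions $\mathbb N^{\mathbb N}\times\mathbb N\to\mathbb N$ that contains all $(l,n)\mapsto p(n)$, $p$ a polynomial with natural coefficients, and contains with $P$ and $Q$ also $P+Q$, $P\cdot Q$ and $(l,n)\mapsto l(P(l,n))$. A functional is polynomial-time computable if it can be computed in time $P$ for some second-order polynomial $P$. **Proposition.** Let $F,G\colon\mathcal B\to\mathcal B$ be functionals that can be computed in times $T$ and $S$, respectively. Then there is a $C\in\mathbb N$ such that $F\circ G$ can be computed in time $$(l,n)\mapsto C\cdot\bigl(T(S(l,\cdot),n)+S(l,T(S(l,\cdot),n))\cdot T(S(l,\cdot),n)\bigr).$$ In particular, if $F$ and $G$ are polynomial-time computable, then so is $F\circ G$. -/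

import Mathlib

namespace SecondOrder

/-- String functions: the Baire space, realized as the functions from binary strings to
binary strings. -/
abbrev Baire : Type := List Bool → List Bool

/-! ### Multi-tape oracle Turing machines -/

/-- Tape symbols: the blank, the two letters of the input alphabet, and finitely many auxiliary
symbols that depend on the machine. -/
inductive Symbol (Γ : Type) : Type
  | blank : Symbol Γ
  | bit : Bool → Symbol Γ
  | aux : Γ → Symbol Γ

/-- The tapes: one input tape, one output tape, one oracle query tape, and work tapes. -/
inductive TapeId (ι : Type) : Type
  | input : TapeId ι
  | output : TapeId ι
  | query : TapeId ι
  | work : ι → TapeId ι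

/-- Head moves. -/
inductive Move : Type
  | left : Move
  | stay : Move
  | right : Move

/-- States: the termination state, the oracle query state, and the ordinary states. -/
inductive State (Q : Type) : Type
  | halt : State Q
  | query : State Q
  | ctrl : Q → State Q

/-- A one-sided infinite tape together with the position of its head. -/
structure Tape (Γ : Type) : Type where
  cells : ℕ → Symbol Γ
  pos : ℕ

/-- The longest initial segment consisting of letters of the input alphabet. -/
def bitsPrefix {Γ : Type} : List (Symbol Γ) → List Bool
  | Symbol.bit b :: s => b :: bitsPrefix s
  | _ => []

namespace Tape

variable {Γ : Type}

/-- The tape with content `w` (and blanks afterwards) and head position `p`. -/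
def ofString (w : List Bool) (p : ℕ) : Tape Γ where
  cells i := match w[i]? with
    | some b => Symbol.bit b
    | none => Symbol.blank
  pos := p

/-- The symbol under the head. -/
def read (t : Tape Γ) : Symbol Γ := t.cells t.pos

/-- Write a symbol, then move the head; a left move on the first cell has no effect. -/
def act (t : Tape Γ) (x : Symbol Γ × Move) : Tape Γ where
  cells := Function.update t.cells t.pos x.1
  pos := match x.2 with
    | Move.left => t.pos - 1
    | Move.stay => t.pos
    | Move.right => t.pos + 1

/-- The string on a tape: it starts in the first cell and extends to the right until the head
position (exclusive) or the first cell that does not hold a letter, whichever comes first.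
So a string is asked as an oracle query, or returned as output, with the head right behind it, and
a machine can only ask queries whose length is at most the number of steps done so far. -/
def content (t : Tape Γ) : List Bool := bitsPrefix ((List.range t.pos).map t.cells)

end Tape

/-- Deterministic multi-tape oracle Turing machines. `start` is the initial state, and `answer`
is the state in which the computation continues after an oracle query. -/
structure OracleTM : Type 1 where
  Γ : Type
  ι : Type
  Q : Type
  finite_Γ : Finite Γ
  finite_ι : Finite ι
  finite_Q : Finite Q
  start : State Q
  answer : State Q
  trans : Q → (TapeId ι → Symbol Γ) → State Q × (TapeId ι → Symbol Γ × Move)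

namespace OracleTM

/-- Configurations. -/
structure Cfg (M : OracleTM) : Type where
  state : State M.Q
  tapes : TapeId M.ι → Tape M.Γ

/-- The initial configuration: the input is on the input tape, all other tapes are blank, and all
heads are on the first cells. -/
def init (M : OracleTM) (a : List Bool) : M.Cfg where
  state := M.start
  tapes
    | TapeId.input => Tape.ofString a 0
    | _ => Tape.ofString [] 0

/-- One step with oracle `φ`. In the query state the string `b` on the query tape is replaced by
`φ b` (the tape is blank after `φ b`), and no head moves; this takes one step.
A halted configuration does not change any more. -/
def step (M : OracleTM) (φ : Baire) (c : M.Cfg) : M.Cfg :=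
  match c.state with
  | State.halt => c
  | State.query =>
    { state := M.answer
      tapes := fun i => match i with
        | TapeId.query =>
          Tape.ofString (φ (c.tapes TapeId.query).content) (c.tapes TapeId.query).pos
        | j => c.tapes j }
  | State.ctrl q =>
    { state := (M.trans q fun i => (c.tapes i).read).1
      tapes := fun i => (c.tapes i).act ((M.trans q fun j => (c.tapes j).read).2 i) }

/-- The configuration after `t` steps with oracle `φ` on input `a`. -/
def run (M : OracleTM) (φ : Baire) (a : List Bool) (t : ℕ) : M.Cfg :=
  (M.step φ)^[t] (M.init a)

/-- The run with oracle `φ` on input `a` terminates within `t` steps. -/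
def HaltsWithin (M : OracleTM) (φ : Baire) (a : List Bool) (t : ℕ) : Prop :=
  (M.run φ a t).state = State.halt

/-- `M` computes the functional `F`: with every oracle `φ` and on every input `a`, the run
terminates, and the string on the output tape is then `F φ a`. -/
def Computes (M : OracleTM) (F : Baire → Baire) : Prop :=
  ∀ (φ : Baire) (a : List Bool), ∃ t : ℕ,
    M.HaltsWithin φ a t ∧ ((M.run φ a t).tapes TapeId.output).content = F φ a

end OracleTM

/-! ### Running times -/

/-- The size function of a string function: `size φ n` is the maximum of the lengths of the
`φ a` over all strings `a` of length at most `n`. -/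
def size (φ : Baire) (n : ℕ) : ℕ :=
  (Finset.range (n + 1)).sup fun k =>
    (Finset.univ : Finset (List.Vector Bool k)).sup fun a => (φ a.toList).length

/-- Running times: monotone in both arguments as long as the functional argument is monotone. -/
def IsRunningTime (T : (ℕ → ℕ) → ℕ → ℕ) : Prop :=
  ∀ l l' : ℕ → ℕ, Monotone l → Monotone l' → l' ≤ l →
    Monotone (T l) ∧ Monotone (T l') ∧ T l' ≤ T l

/-- `T` is a running time for the machine `M`. -/
def OracleTM.RunsInTime (M : OracleTM) (T : (ℕ → ℕ) → ℕ → ℕ) : Prop :=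
  IsRunningTime T ∧
    ∀ (φ : Baire) (a : List Bool), M.HaltsWithin φ a (T (size φ) a.length)

/-- The functional `F` can be computed in time `T`. -/
def ComputableInTime (F : Baire → Baire) (T : (ℕ → ℕ) → ℕ → ℕ) : Prop :=
  ∃ M : OracleTM, M.Computes F ∧ M.RunsInTime T

/-- Second-order polynomials. -/
inductive IsSecondOrderPoly : ((ℕ → ℕ) → ℕ → ℕ) → Prop
  | poly (p : Polynomial ℕ) : IsSecondOrderPoly fun _ n => p.eval n
  | add {P R : (ℕ → ℕ) → ℕ → ℕ} : IsSecondOrderPoly P → IsSecondOrderPoly R →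
      IsSecondOrderPoly fun l n => P l n + R l n
  | mul {P R : (ℕ → ℕ) → ℕ → ℕ} : IsSecondOrderPoly P → IsSecondOrderPoly R →
      IsSecondOrderPoly fun l n => P l n * R l n
  | app {P : (ℕ → ℕ) → ℕ → ℕ} : IsSecondOrderPoly P →
      IsSecondOrderPoly fun l n => l (P l n)

/-- Polynomial-time computable functionals. -/
def PolyTimeComputable (F : Baire → Baire) : Prop :=
  ∃ P : (ℕ → ℕ) → ℕ → ℕ, IsSecondOrderPoly P ∧ ComputableInTime F P

end SecondOrder

/-! Let `M₁` compute `F` and `M₂` compute `G`. The composed machine runs `M₁` and answers each query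
`b` by running `M₂` on `b`. Put `l = size φ`, `L = T (S l) n` and `K = S l L`. Heads move at most
one cell per step, so an output is never longer than the running time. Hence `size (G φ) ≤ S l`, and
by monotonicity `M₁` stops within `L` steps, asks only queries of length at most `L`, and each inner
run takes at most `K` steps. The simulated steps thus number `O(L + K * L)`; the work lies in
keeping the bookkeeping within a constant factor of this.

Three things stand in the way. The head of the outer query tape keeps its position `p` during a
query, and `p` may be far larger than `K`, so walking to `p` after each answer could cost `L ^ 2`.
Therefore the tape `cont` stops at the end of a short answer, and the missing distance is a head
position on `disp`. This is harmless for the next query, because the blank behind the answer ends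
the word. Cells visited since the last query are kept on a two-sided tape centred at `p`, laid over
the answer (`QueryRep.act`). Handling a query costs `O(K)` plus twice the head position of `cont`;
that last part is a potential, built up by earlier steps and answers (`reachesIn_outer`).

The tapes of the inner machine must be wiped between runs. The composed machine is a `ResetTM`,
which wipes in one step. An ordinary machine marks visited cells and sweeps over them, and each
sweep is paid for by the steps that first visited those cells (`rightCost_add_potential_le`,
`ResetTM.exists_oracleTM`).

The real query tape cannot be wiped, as it may hold an old answer longer than the time available.
The inner machine uses a clean work tape until its first query, after which the oracle has itself
replaced the old content (`reachesIn_inner`).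

For the polynomial case, second-order polynomials are closed under substitution in either argument.
-/

namespace SecondOrder

/-! ### Reaching a goal within a number of steps -/

/-- Iterating `f` from `c` meets `P` after at most `B` steps. -/
def ReachesIn {α : Type*} (f : α → α) (P : α → Prop) (c : α) (B : ℕ) : Prop :=
  ∃ n ≤ B, P (f^[n] c)

namespace ReachesIn

variable {α : Type*} {f : α → α} {P : α → Prop} {c : α} {B B' : ℕ}

theorem of_holds (h : P c) : ReachesIn f P c B := ⟨0, Nat.zero_le _, h⟩

theorem of_step (h : ReachesIn f P (f c) B) : ReachesIn f P c (B + 1) := by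
  obtain ⟨n, hn, h⟩ := h
  exact ⟨n + 1, by omega, by simpa [Function.iterate_succ_apply] using h⟩

theorem mono (h : ReachesIn f P c B) (hB : B ≤ B') : ReachesIn f P c B' := by
  obtain ⟨n, hn, h⟩ := h
  exact ⟨n, by omega, h⟩

end ReachesIn

/-! ### Relabelling symbols and tapes -/

/-- Rename the auxiliary symbols. -/
def Symbol.map {Γ Δ : Type} (e : Γ → Δ) : Symbol Γ → Symbol Δ
  | Symbol.blank => Symbol.blank
  | Symbol.bit b => Symbol.bit b
  | Symbol.aux g => Symbol.aux (e g)

theorem Symbol.map_injective {Γ Δ : Type} {e : Γ → Δ} (he : Function.Injective e) :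
    Function.Injective (Symbol.map e) := by
  intro a b h
  cases a <;> cases b <;> simp_all [Symbol.map]
  exact he h

instance {Γ : Type} : Inhabited (Symbol Γ) := ⟨Symbol.blank⟩

/-- A left inverse of `Symbol.map e` for injective `e`. -/
noncomputable def Symbol.unmap {Γ Δ : Type} (e : Γ → Δ) : Symbol Δ → Symbol Γ :=
  Function.invFun (Symbol.map e)

theorem Symbol.unmap_map {Γ Δ : Type} {e : Γ → Δ} (he : Function.Injective e) (s : Symbol Γ) :
    Symbol.unmap e (Symbol.map e s) = s :=
  Function.leftInverse_invFun (Symbol.map_injective he) s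

instance {Γ : Type} [Finite Γ] : Finite (Symbol Γ) :=
  Finite.of_injective
    (fun s : Symbol Γ => match s with
      | Symbol.blank => (none : Option (Bool ⊕ Γ))
      | Symbol.bit b => some (Sum.inl b)
      | Symbol.aux g => some (Sum.inr g))
    (by intro a b; cases a <;> cases b <;> simp)

instance {ι : Type} [Finite ι] : Finite (TapeId ι) :=
  Finite.of_injective
    (fun s : TapeId ι => match s with
      | TapeId.input => (Sum.inl 0 : Fin 3 ⊕ ι)
      | TapeId.output => Sum.inl 1
      | TapeId.query => Sum.inl 2
      | TapeId.work i => Sum.inr i)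
    (by intro a b; cases a <;> cases b <;> simp)

instance {Q : Type} [Finite Q] : Finite (State Q) :=
  Finite.of_injective
    (fun s : State Q => match s with
      | State.halt => (Sum.inl 0 : Fin 2 ⊕ Q)
      | State.query => Sum.inl 1
      | State.ctrl q => Sum.inr q)
    (by intro a b; cases a <;> cases b <;> simp)

theorem bitsPrefix_map {Γ Δ : Type} (e : Γ → Δ) (l : List (Symbol Γ)) :
    bitsPrefix (l.map (Symbol.map e)) = bitsPrefix l := by
  induction l with
  | nil => rfl
  | cons s l ih => cases s <;> simp [bitsPrefix, Symbol.map, ih]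

namespace Tape

variable {Γ Δ : Type}

@[ext] theorem ext {t u : Tape Γ} (h : t.cells = u.cells) (h' : t.pos = u.pos) : t = u := by
  cases t; cases u; simp_all

/-- Rename the auxiliary symbols on a tape. -/
def map (e : Γ → Δ) (t : Tape Γ) : Tape Δ where
  cells i := (t.cells i).map e
  pos := t.pos

@[simp] theorem map_pos (e : Γ → Δ) (t : Tape Γ) : (t.map e).pos = t.pos := rfl

@[simp] theorem map_cells (e : Γ → Δ) (t : Tape Γ) (i : ℕ) :
    (t.map e).cells i = (t.cells i).map e := rfl

@[simp] theorem map_read (e : Γ → Δ) (t : Tape Γ) : (t.map e).read = t.read.map e := rfl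

@[simp] theorem map_act (e : Γ → Δ) (t : Tape Γ) (x : Symbol Γ × Move) :
    (t.map e).act (x.1.map e, x.2) = (t.act x).map e := by
  ext i
  · by_cases h : i = t.pos
    · subst h; simp [act]
    · simp [act, Function.update_of_ne h]
  · rfl

@[simp] theorem map_ofString (e : Γ → Δ) (w : List Bool) (p : ℕ) :
    (ofString w p : Tape Γ).map e = ofString w p := by
  ext i
  · simp only [map, ofString]
    cases w[i]? <;> rfl
  · rfl

theorem content_congr {t u : Tape Γ} (hp : t.pos = u.pos)
    (h : ∀ i < u.pos, t.cells i = u.cells i) : t.content = u.content := by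
  unfold content
  rw [hp]
  congr 1
  exact List.map_congr_left fun i hi => h i (List.mem_range.1 hi)

@[simp] theorem content_map (e : Γ → Δ) (t : Tape Γ) : (t.map e).content = t.content := by
  unfold content
  rw [← bitsPrefix_map e, List.map_map]
  rfl

@[simp] theorem act_read_stay (t : Tape Γ) : t.act (t.read, Move.stay) = t := by
  ext
  · simp [act, read]
  · rfl

/-- The effect of a move on the head position. -/
def movePos : Move → ℕ → ℕ
  | Move.left, p => p - 1
  | Move.stay, p => p
  | Move.right, p => p + 1

theorem act_pos (t : Tape Γ) (s : Symbol Γ) (m : Move) : (t.act (s, m)).pos = movePos m t.pos := by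
  cases m <;> rfl

@[simp] theorem act_left_pos (t : Tape Γ) (s : Symbol Γ) :
    (t.act (s, Move.left)).pos = t.pos - 1 := rfl
@[simp] theorem act_stay_pos (t : Tape Γ) (s : Symbol Γ) :
    (t.act (s, Move.stay)).pos = t.pos := rfl
@[simp] theorem act_right_pos (t : Tape Γ) (s : Symbol Γ) :
    (t.act (s, Move.right)).pos = t.pos + 1 := rfl

theorem act_cells (t : Tape Γ) (x : Symbol Γ × Move) (i : ℕ) :
    (t.act x).cells i = if i = t.pos then x.1 else t.cells i := by
  simp [act, Function.update_apply]

@[simp] theorem act_read_cells (t : Tape Γ) (m : Move) :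
    (t.act (t.read, m)).cells = t.cells := by
  simp [act, read]

@[simp] theorem ofString_pos (w : List Bool) (p : ℕ) : (ofString w p : Tape Γ).pos = p := rfl

@[simp] theorem ofString_nil_cells (p i : ℕ) :
    (ofString [] p : Tape Γ).cells i = Symbol.blank := rfl

theorem ofString_cells_ge (w : List Bool) (p : ℕ) {i : ℕ} (h : w.length ≤ i) :
    (ofString w p : Tape Γ).cells i = Symbol.blank := by
  simp [ofString, h]

theorem length_bitsPrefix_le (l : List (Symbol Γ)) : (bitsPrefix l).length ≤ l.length := by
  induction l with
  | nil => simp [bitsPrefix]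
  | cons s l ih => cases s <;> simp [bitsPrefix, ih]

theorem length_content_le (t : Tape Γ) : t.content.length ≤ t.pos := by
  simpa [content] using length_bitsPrefix_le ((List.range t.pos).map t.cells)

end Tape

/-! ### Machines that can rewind and wipe work tapes -/

/-- What happens to a work tape after the ordinary action. -/
inductive Post : Type
  | keep : Post
  | home : Post
  | reset : Post

instance : Finite Post :=
  Finite.of_injective
    (fun s : Post => match s with
      | Post.keep => (0 : Fin 3)
      | Post.home => 1
      | Post.reset => 2)
    (by intro a b; cases a <;> cases b <;> simp)

/-- `home` moves the head to the first cell, `reset` also wipes the tape. -/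
def Post.apply {Γ : Type} : Post → Tape Γ → Tape Γ
  | Post.keep, t => t
  | Post.home, t => { t with pos := 0 }
  | Post.reset, _ => Tape.ofString [] 0

/-- Oracle Turing machines that see which heads of work tapes are on the first cell, and that can
in one step move the head of a work tape to the first cell and wipe a work tape. -/
structure ResetTM : Type 1 where
  Γ : Type
  ι : Type
  Q : Type
  finite_Γ : Finite Γ
  finite_ι : Finite ι
  finite_Q : Finite Q
  start : State Q
  answer : State Q
  trans : Q → (TapeId ι → Symbol Γ) → (ι → Bool) →
    State Q × (TapeId ι → Symbol Γ × Move) × (ι → Post)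

namespace ResetTM

/-- Configurations. -/
structure Cfg (N : ResetTM) : Type where
  state : State N.Q
  tapes : TapeId N.ι → Tape N.Γ

variable (N : ResetTM)

/-- The initial configuration. -/
def init (a : List Bool) : N.Cfg where
  state := N.start
  tapes
    | TapeId.input => Tape.ofString a 0
    | _ => Tape.ofString [] 0

/-- The transition taken from state `q` with the given tapes. -/
def next (q : N.Q) (ts : TapeId N.ι → Tape N.Γ) :
    State N.Q × (TapeId N.ι → Symbol N.Γ × Move) × (N.ι → Post) :=
  N.trans q (fun i => (ts i).read) fun k => decide ((ts (TapeId.work k)).pos = 0)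

/-- One step with oracle `φ`. -/
def step (φ : Baire) (c : N.Cfg) : N.Cfg :=
  match c.state with
  | State.halt => c
  | State.query =>
    { state := N.answer
      tapes := fun i => match i with
        | TapeId.query =>
          Tape.ofString (φ (c.tapes TapeId.query).content) (c.tapes TapeId.query).pos
        | j => c.tapes j }
  | State.ctrl q =>
    { state := (N.next q c.tapes).1
      tapes := fun i => match i with
        | TapeId.work k => ((N.next q c.tapes).2.2 k).apply
            ((c.tapes (TapeId.work k)).act ((N.next q c.tapes).2.1 (TapeId.work k)))
        | j => (c.tapes j).act ((N.next q c.tapes).2.1 j) }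

/-- The goal of a run: termination with output `w`. -/
def Outputs (w : List Bool) (c : N.Cfg) : Prop :=
  c.state = State.halt ∧ (c.tapes TapeId.output).content = w

end ResetTM

/-- The goal of a run: termination with output `w`. -/
def OracleTM.Outputs (M : OracleTM) (w : List Bool) (c : M.Cfg) : Prop :=
  c.state = State.halt ∧ (c.tapes TapeId.output).content = w

namespace ResetTM

/-! ### Simulation by oracle Turing machines -/

/-- Control states of the simulation: `setup` marks the first cells, `run` performs the action of
a step, `right` moves the heads of the tapes to be wiped to the right end of the visited region,
and `left` moves heads back to the first cell. -/
inductive SimState (ι Q : Type) : Type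
  | setup : SimState ι Q
  | run : Q → SimState ι Q
  | right : State Q → (ι → Post) → SimState ι Q
  | left : State Q → (ι → Post) → SimState ι Q

instance {ι Q : Type} [Finite ι] [Finite Q] : Finite (SimState ι Q) :=
  Finite.of_injective
    (fun s : SimState ι Q => match s with
      | SimState.setup => (Sum.inl none : Option Q ⊕ (Bool × State Q × (ι → Post)))
      | SimState.run q => Sum.inl (some q)
      | SimState.right s k => Sum.inr (true, s, k)
      | SimState.left s k => Sum.inr (false, s, k))
    (by intro a b; cases a <;> cases b <;> simp)

/-- The state of the simulation in which the simulated machine continues in state `s`. -/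
def SimState.enter {ι Q : Type} : State Q → State (SimState ι Q)
  | State.halt => State.halt
  | State.query => State.query
  | State.ctrl q => State.ctrl (SimState.run q)

/-- Auxiliary symbols of the simulation: those of the simulated machine, and visited cells of work
tapes with a flag for the first cell. -/
abbrev SimSymbol (Γ : Type) : Type := Γ ⊕ (Bool × Symbol Γ)

/-- A visited cell. -/
def visited {Γ : Type} (b : Bool) (s : Symbol Γ) : Symbol (SimSymbol Γ) :=
  Symbol.aux (Sum.inr (b, s))

/-- The symbol of a work tape represented by a symbol of the simulation. -/
def unvisit {Γ : Type} : Symbol (SimSymbol Γ) → Symbol Γ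
  | Symbol.aux (Sum.inr (_, s)) => s
  | _ => Symbol.blank

/-- Whether a cell carries the flag of the first cell. -/
def isFirst {Γ : Type} : Symbol (SimSymbol Γ) → Bool
  | Symbol.aux (Sum.inr (b, _)) => b
  | _ => false

@[simp] theorem isFirst_visited {Γ : Type} (b : Bool) (s : Symbol Γ) :
    isFirst (visited b s) = b := rfl
@[simp] theorem isFirst_blank {Γ : Type} : isFirst (Symbol.blank : Symbol (SimSymbol Γ)) = false :=
  rfl
@[simp] theorem visited_ne_blank {Γ : Type} (b : Bool) (s : Symbol Γ) :
    visited b s ≠ Symbol.blank := by simp [visited]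

variable (N : ResetTM)

/-- What the simulated machine reads. -/
noncomputable def simRead (rd : TapeId N.ι → Symbol (SimSymbol N.Γ)) : TapeId N.ι → Symbol N.Γ
  | TapeId.work k => unvisit (rd (TapeId.work k))
  | i => Symbol.unmap Sum.inl (rd i)

/-- The simulated transition. -/
noncomputable def simNext (q : N.Q) (rd : TapeId N.ι → Symbol (SimSymbol N.Γ)) :
    State N.Q × (TapeId N.ι → Symbol N.Γ × Move) × (N.ι → Post) :=
  N.trans q (N.simRead rd) fun k => isFirst (rd (TapeId.work k))

open Classical in
/-- The action on a work tape in the state `right`. -/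
noncomputable def rightAct {Γ : Type} (k : Post) (s : Symbol (SimSymbol Γ)) :
    Symbol (SimSymbol Γ) × Move :=
  (s, if k = Post.reset ∧ s ≠ Symbol.blank then Move.right else Move.stay)

/-- The action on a work tape in the state `left`. -/
def leftAct {Γ : Type} (k : Post) (s : Symbol (SimSymbol Γ)) : Symbol (SimSymbol Γ) × Move :=
  match k with
  | Post.keep => (s, Move.stay)
  | Post.home => (s, if isFirst s then Move.stay else Move.left)
  | Post.reset => if isFirst s then (visited true Symbol.blank, Move.stay)
    else (Symbol.blank, Move.left)

open Classical in
/-- The oracle Turing machine that simulates `N`. -/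
noncomputable abbrev toOracleTM : OracleTM where
  Γ := SimSymbol N.Γ
  ι := N.ι
  Q := SimState N.ι N.Q
  finite_Γ := by
    have := N.finite_Γ
    infer_instance
  finite_ι := N.finite_ι
  finite_Q := by
    have := N.finite_ι
    have := N.finite_Q
    infer_instance
  start := State.ctrl SimState.setup
  answer := SimState.enter N.answer
  trans q rd := match q with
    | SimState.setup => (SimState.enter N.start, fun i => match i with
      | TapeId.work _ => (visited true Symbol.blank, Move.stay)
      | j => (rd j, Move.stay))
    | SimState.run q => (State.ctrl (SimState.right (N.simNext q rd).1 (N.simNext q rd).2.2),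
      fun i => match i with
      | TapeId.work k => (visited (isFirst (rd (TapeId.work k)))
          ((N.simNext q rd).2.1 (TapeId.work k)).1, ((N.simNext q rd).2.1 (TapeId.work k)).2)
      | j => (((N.simNext q rd).2.1 j).1.map Sum.inl, ((N.simNext q rd).2.1 j).2))
    | SimState.right s k =>
      (if ∀ i, k i = Post.reset → rd (TapeId.work i) = Symbol.blank
        then State.ctrl (SimState.left s k) else State.ctrl (SimState.right s k),
      fun i => match i with
      | TapeId.work j => rightAct (k j) (rd (TapeId.work j))
      | j => (rd j, Move.stay))
    | SimState.left s k =>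
      (if ∀ i, k i ≠ Post.keep → isFirst (rd (TapeId.work i)) = true
        then SimState.enter s else State.ctrl (SimState.left s k),
      fun i => match i with
      | TapeId.work j => leftAct (k j) (rd (TapeId.work j))
      | j => (rd j, Move.stay))

/-! #### Representation of a work tape -/

/-- The tape `P` of the simulation represents the work tape `t`, of which the first `h` cells have
been visited. -/
structure Rep {Γ : Type} (P : Tape (SimSymbol Γ)) (t : Tape Γ) (h : ℕ) : Prop where
  pos_eq : P.pos = t.pos
  pos_le : t.pos ≤ h
  one_le : 1 ≤ h
  low : ∀ j < h, P.cells j = visited (decide (j = 0)) (t.cells j)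
  high : ∀ j, h ≤ j → P.cells j = Symbol.blank ∧ t.cells j = Symbol.blank

section Rep

variable {Γ : Type} {P : Tape (SimSymbol Γ)} {t : Tape Γ} {h : ℕ}

theorem Rep.unvisit_read (r : Rep P t h) : unvisit P.read = t.read := by
  unfold Tape.read
  rw [r.pos_eq]
  rcases lt_or_ge t.pos h with hl | hl
  · rw [r.low _ hl]; rfl
  · rw [(r.high _ hl).1, (r.high _ hl).2]; rfl

theorem Rep.isFirst_read (r : Rep P t h) : isFirst P.read = decide (t.pos = 0) := by
  unfold Tape.read
  rw [r.pos_eq]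
  rcases lt_or_ge t.pos h with hl | hl
  · rw [r.low _ hl]; rfl
  · have := r.one_le
    rw [(r.high _ hl).1]
    simp only [isFirst_blank]
    symm
    rw [decide_eq_false_iff_not]
    omega

/-- The head is at most at the right end of the visited region, so a write keeps the region an
initial segment and lengthens it by at most one cell. Copying the flag from the cell read is correct
because the first cell is visited from the start. -/
theorem Rep.act (r : Rep P t h) (x : Symbol Γ × Move) :
    ∃ h' ≤ h + 1, Rep (P.act (visited (isFirst P.read) x.1, x.2)) (t.act x) h' := by
  have hp := r.pos_eq
  have hle := r.pos_le
  have h1 := r.one_le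
  have hpos : (P.act (visited (isFirst P.read) x.1, x.2)).pos = (t.act x).pos := by
    simp only [Tape.act, hp]
  have hpos' : (t.act x).pos ≤ t.pos + 1 := by
    obtain ⟨s, m⟩ := x
    cases m <;> grind [Tape.act_left_pos, Tape.act_stay_pos, Tape.act_right_pos]
  refine ⟨max h (t.pos + 1), by omega, hpos, by omega, by omega, ?_, ?_⟩
  · intro j hj
    rw [Tape.act_cells, Tape.act_cells, hp]
    split_ifs with hjp
    · subst hjp
      rw [r.isFirst_read]
    · exact r.low j (by omega)
  · intro j hj
    rw [Tape.act_cells, Tape.act_cells, hp, if_neg (by omega), if_neg (by omega)]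
    exact r.high j (by omega)

theorem Rep.congr_pos (r : Rep P t h) {P' : Tape (SimSymbol Γ)} (hc : P'.cells = P.cells)
    (hp : P'.pos ≤ h) : Rep P' { t with pos := P'.pos } h :=
  ⟨rfl, hp, r.one_le, by rw [hc]; exact r.low, by rw [hc]; exact r.high⟩

/-- The tape `P` is being wiped from right to left. -/
structure Wiping (P : Tape (SimSymbol Γ)) : Prop where
  first : isFirst (P.cells 0) = true
  not_first : ∀ j, 0 < j → isFirst (P.cells j) = false
  blank : ∀ j, P.pos < j → P.cells j = Symbol.blank

/-- A visited cell is never literally blank, even if it represents a blank. So a head that reads a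
blank stands at the end of the visited region, and a sweep to the left from there misses nothing. -/
theorem Wiping.of_rep (r : Rep P t h) (hb : P.read = Symbol.blank) : Wiping P := by
  have hp : P.pos = h := by
    by_contra hne
    have := r.pos_le
    have := r.pos_eq
    rw [Tape.read, r.low _ (by omega)] at hb
    exact visited_ne_blank _ _ hb
  have h1 := r.one_le
  refine ⟨by rw [r.low 0 (by omega)]; rfl, fun j hj => ?_, fun j hj => (r.high j (by omega)).1⟩
  rcases lt_or_ge j h with hl | hl
  · rw [r.low j hl]
    simp only [isFirst_visited, decide_eq_false_iff_not]
    omega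
  · rw [(r.high j hl).1]; rfl

end Rep

end ResetTM

/-! ### Rewinding and wiping a work tape: invariants, costs, potential -/

namespace ResetTM

section Phases

variable {Γ : Type} {P : Tape (SimSymbol Γ)} {t : Tape Γ} {h : ℕ} {k : Post}

theorem Wiping.pos_eq_zero (r : Wiping P) (hf : isFirst P.read = true) : P.pos = 0 := by
  by_contra hne
  rw [Tape.read, r.not_first _ (by omega)] at hf
  exact Bool.false_ne_true hf

theorem Wiping.pos_pos (r : Wiping P) (hf : isFirst P.read = false) : 0 < P.pos := by
  by_contra hne
  rw [Tape.read, show P.pos = 0 by omega, r.first] at hf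
  exact Bool.false_ne_true hf.symm

theorem Wiping.step (r : Wiping P) : Wiping (P.act (leftAct Post.reset P.read)) := by
  cases hf : isFirst P.read
  · have hp := r.pos_pos hf
    simp only [leftAct, hf, Bool.false_eq_true, if_false]
    refine ⟨?_, fun j hj => ?_, fun j hj => ?_⟩
    · rw [Tape.act_cells, if_neg (by omega)]
      exact r.first
    · rw [Tape.act_cells]
      split_ifs
      · rfl
      · exact r.not_first j hj
    · rw [Tape.act_cells]
      rw [Tape.act_left_pos] at hj
      split_ifs
      · rfl
      · exact r.blank j (by omega)
  · have hp := r.pos_eq_zero hf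
    simp only [leftAct, hf, if_true]
    refine ⟨?_, fun j hj => ?_, fun j hj => ?_⟩
    · rw [Tape.act_cells, if_pos hp.symm]
      rfl
    · rw [Tape.act_cells, if_neg (by omega)]
      exact r.not_first j hj
    · rw [Tape.act_stay_pos] at hj
      rw [Tape.act_cells, if_neg (by omega)]
      exact r.blank j (by omega)

theorem Wiping.rep (r : Wiping P) (hf : isFirst P.read = true) :
    Rep (P.act (leftAct Post.reset P.read)) (Tape.ofString [] 0) 1 := by
  have hp := r.pos_eq_zero hf
  simp only [leftAct, hf, if_true]
  refine ⟨by simpa using hp, by simp, le_rfl, fun j hj => ?_, fun j hj => ⟨?_, rfl⟩⟩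
  · rw [Tape.act_cells, if_pos (by omega), show j = 0 by omega]
    rfl
  · rw [Tape.act_cells, if_neg (by omega)]
    exact r.blank j (by omega)

/-- Invariant of a work tape in the state `left`, where `t` is the resulting tape. -/
def LeftInv (k : Post) (P : Tape (SimSymbol Γ)) (t : Tape Γ) (h : ℕ) : Prop :=
  match k with
  | Post.keep => Rep P t h
  | Post.home => t.pos = 0 ∧ Rep P { t with pos := P.pos } h
  | Post.reset => t = Tape.ofString [] 0 ∧ h = 1 ∧ Wiping P

/-- The remaining number of steps for a work tape in the state `left`. -/
def leftCost (k : Post) (p : ℕ) : ℕ :=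
  match k with
  | Post.keep => 0
  | _ => p

theorem rep_home_step {u : Tape Γ} (r : Rep P { u with pos := P.pos } h) :
    Rep (P.act (leftAct Post.home P.read))
      { u with pos := (P.act (leftAct Post.home P.read)).pos } h := by
  refine r.congr_pos ?_ ?_
  · simp [leftAct]
  · have := r.pos_le
    simp only at this
    cases hf : isFirst P.read <;> simp only [leftAct, hf] <;> simp <;> omega

/-- All tapes are swept simultaneously. No cost increases, and a tape still away from its flag gets
strictly cheaper, so the sum of the costs measures the remaining duration of the phase. -/
theorem LeftInv.step (r : LeftInv k P t h) :
    LeftInv k (P.act (leftAct k P.read)) t h ∧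
      leftCost k (P.act (leftAct k P.read)).pos ≤ leftCost k P.pos ∧
      (k ≠ Post.keep → isFirst P.read = false →
        leftCost k (P.act (leftAct k P.read)).pos < leftCost k P.pos) := by
  cases k with
  | keep =>
    refine ⟨?_, le_rfl, fun h => absurd rfl h⟩
    simpa [leftAct] using r
  | home =>
    obtain ⟨h0, r⟩ := r
    refine ⟨⟨h0, rep_home_step r⟩, ?_, fun _ hf => ?_⟩
    · cases hf : isFirst P.read <;> simp [leftCost, leftAct, hf]
    · have := r.isFirst_read
      rw [hf] at this
      simp only [leftCost, leftAct, hf, Bool.false_eq_true, if_false, Tape.act_left_pos]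
      have := of_decide_eq_false this.symm
      simp only at this
      omega
  | reset =>
    obtain ⟨h0, h1, r⟩ := r
    refine ⟨⟨h0, h1, r.step⟩, ?_, fun _ hf => ?_⟩
    · cases hf : isFirst P.read <;> simp [leftCost, leftAct, hf]
    · have := r.pos_pos hf
      simp only [leftCost, leftAct, hf, Bool.false_eq_true, if_false, Tape.act_left_pos]
      omega

theorem LeftInv.rep (r : LeftInv k P t h) (hf : k ≠ Post.keep → isFirst P.read = true) :
    Rep (P.act (leftAct k P.read)) t h := by
  cases k with
  | keep => simpa [leftAct, LeftInv] using r
  | home =>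
    obtain ⟨h0, r⟩ := r
    have hf := hf (by simp)
    rw [r.isFirst_read] at hf
    have hp : P.pos = 0 := by simpa using hf
    have := r.isFirst_read
    have e : ({ t with pos := P.pos } : Tape Γ) = t := by
      ext
      · rfl
      · simp [hp, h0]
    rw [e] at r this
    simpa [leftAct, this, h0] using r
  | reset =>
    obtain ⟨rfl, rfl, r⟩ := r
    exact r.rep (hf (by simp))

/-- Invariant of a work tape in the state `right`, where `t` is the resulting tape. -/
def RightInv (k : Post) (P : Tape (SimSymbol Γ)) (t : Tape Γ) (h : ℕ) : Prop :=
  match k with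
  | Post.keep => Rep P t h
  | Post.home => t.pos = 0 ∧ Rep P { t with pos := P.pos } h
  | Post.reset => t = Tape.ofString [] 0 ∧ ∃ u, Rep P u h

/-- The remaining number of steps for a work tape in the state `right`, with `h` visited cells. -/
def rightCost (k : Post) (p h : ℕ) : ℕ :=
  match k with
  | Post.keep => 0
  | Post.home => p
  | Post.reset => h + (h - p)

/-- The number of visited cells after the final operation. -/
def finalExtent (k : Post) (h : ℕ) : ℕ :=
  match k with
  | Post.reset => 1
  | _ => h

theorem RightInv.step (r : RightInv k P t h) :
    RightInv k (P.act (rightAct k P.read)) t h ∧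
      rightCost k (P.act (rightAct k P.read)).pos h ≤ rightCost k P.pos h ∧
      (k = Post.reset → P.read ≠ Symbol.blank →
        rightCost k (P.act (rightAct k P.read)).pos h < rightCost k P.pos h) := by
  cases k with
  | keep =>
    refine ⟨?_, le_rfl, nofun⟩
    simpa [rightAct] using r
  | home =>
    refine ⟨?_, ?_, nofun⟩ <;> simp [rightAct]
    exact r
  | reset =>
    obtain ⟨h0, u, r⟩ := r
    by_cases hb : P.read = Symbol.blank
    · have e : P.act (rightAct Post.reset P.read) = P := by
        rw [rightAct, if_neg (fun h => h.2 hb)]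
        exact Tape.act_read_stay P
      rw [e]
      exact ⟨⟨h0, u, r⟩, le_rfl, fun _ h => absurd hb h⟩
    · have hp : P.pos < h := by
        by_contra hge
        exact hb (r.high P.pos (by omega)).1
      have e : rightAct Post.reset P.read = (P.read, Move.right) := by simp [rightAct, hb]
      rw [e]
      refine ⟨⟨h0, _, r.congr_pos (by simp) (by simpa using hp)⟩, ?_, fun _ _ => ?_⟩ <;>
        simp only [rightCost, Tape.act_right_pos] <;> omega

/-- `rightCost` already contains the way back (`h` for a wipe, the head position for a rewind), so
the change of phase needs no fresh budget. -/
theorem RightInv.left (r : RightInv k P t h) (hb : k = Post.reset → P.read = Symbol.blank) :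
    LeftInv k (P.act (rightAct k P.read)) t (finalExtent k h) ∧
      leftCost k (P.act (rightAct k P.read)).pos ≤ rightCost k P.pos h := by
  cases k with
  | keep =>
    refine ⟨?_, le_rfl⟩
    simpa [rightAct, LeftInv, RightInv, finalExtent] using r
  | home =>
    refine ⟨?_, ?_⟩ <;> simp [rightAct, leftCost, rightCost]
    exact r
  | reset =>
    obtain ⟨h0, u, r⟩ := r
    have hb := hb rfl
    have e : P.act (rightAct Post.reset P.read) = P := by
        rw [rightAct, if_neg (fun h => h.2 hb)]
        exact Tape.act_read_stay P
    rw [e]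
    refine ⟨⟨h0, rfl, Wiping.of_rep r hb⟩, ?_⟩
    have := r.pos_le
    have := r.pos_eq
    simp only [leftCost, rightCost]
    omega

theorem RightInv.of_rep (r : Rep P t h) : RightInv k P (k.apply t) h := by
  cases k with
  | keep => exact r
  | home => exact ⟨rfl, by simpa [Post.apply] using r.congr_pos rfl (r.pos_eq ▸ r.pos_le)⟩
  | reset => exact ⟨rfl, t, r⟩

/-- The part of the potential that comes from one work tape. -/
def potential (t : Tape Γ) (h : ℕ) : ℕ := 2 * h + t.pos

/-- The amortization: a wipe costs `2 * h - p`, paid by the term `2 * h` of the potential it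
destroys, and a rewind costs the head position, which is the other term. The slack `2` is the
potential of a freshly wiped tape, whose flagged first cell still counts as visited. -/
theorem rightCost_add_potential_le (r : Rep P t h) :
    rightCost k P.pos h + potential (k.apply t) (finalExtent k h) ≤ potential t h + 2 := by
  have := r.pos_eq
  have := r.one_le
  cases k <;> simp [rightCost, potential, finalExtent, Post.apply] <;> omega

end Phases

end ResetTM

/-! ### Amortized running time of the simulation -/

namespace ResetTM

variable {N : ResetTM}

/-- The input, output and query tapes of the simulation are those of the simulated machine. -/
def RawEq (ps : TapeId N.ι → Tape (SimSymbol N.Γ)) (ts : TapeId N.ι → Tape N.Γ) : Prop :=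
  ps TapeId.input = (ts TapeId.input).map Sum.inl ∧
    ps TapeId.output = (ts TapeId.output).map Sum.inl ∧
    ps TapeId.query = (ts TapeId.query).map Sum.inl

open Classical in
theorem step_left {φ : Baire} {c : N.toOracleTM.Cfg} {s : State N.Q} {k : N.ι → Post}
    (hc : c.state = State.ctrl (SimState.left s k)) :
    N.toOracleTM.step φ c =
      { state := if ∀ i, k i ≠ Post.keep → isFirst (c.tapes (TapeId.work i)).read = true
          then SimState.enter s else State.ctrl (SimState.left s k)
        tapes := fun i => match i with
          | TapeId.work j => (c.tapes (TapeId.work j)).act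
            (leftAct (k j) (c.tapes (TapeId.work j)).read)
          | j => c.tapes j } := by
  simp only [OracleTM.step, hc]
  congr 1
  funext i
  cases i <;> first | rfl | exact Tape.act_read_stay _

open Classical in
theorem step_right {φ : Baire} {c : N.toOracleTM.Cfg} {s : State N.Q} {k : N.ι → Post}
    (hc : c.state = State.ctrl (SimState.right s k)) :
    N.toOracleTM.step φ c =
      { state := if ∀ i, k i = Post.reset → (c.tapes (TapeId.work i)).read = Symbol.blank
          then State.ctrl (SimState.left s k) else State.ctrl (SimState.right s k)
        tapes := fun i => match i with
          | TapeId.work j => (c.tapes (TapeId.work j)).act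
            (rightAct (k j) (c.tapes (TapeId.work j)).read)
          | j => c.tapes j } := by
  simp only [OracleTM.step, hc]
  congr 1
  funext i
  cases i <;> first | rfl | exact Tape.act_read_stay _

variable {φ : Baire} {G : N.toOracleTM.Cfg → Prop} {s : State N.Q} {k : N.ι → Post}
  {ts : TapeId N.ι → Tape N.Γ} {hs : N.ι → ℕ} {B : ℕ}

theorem simNext_eq {q : N.Q} {ps : TapeId N.ι → Tape (SimSymbol N.Γ)} (hraw : RawEq ps ts)
    (hrep : ∀ i, Rep (ps (TapeId.work i)) (ts (TapeId.work i)) (hs i)) :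
    N.simNext q (fun i => (ps i).read) = N.next q ts := by
  unfold simNext next
  congr 1
  · funext i
    obtain ⟨h1, h2, h3⟩ := hraw
    cases i with
    | work k => exact (hrep k).unvisit_read
    | input => simp [simRead, h1, Symbol.unmap_map Sum.inl_injective]
    | output => simp [simRead, h2, Symbol.unmap_map Sum.inl_injective]
    | query => simp [simRead, h3, Symbol.unmap_map Sum.inl_injective]
  · funext k
    exact (hrep k).isFirst_read

theorem step_run {c : N.toOracleTM.Cfg} {q : N.Q}
    (hc : c.state = State.ctrl (SimState.run q)) (hraw : RawEq c.tapes ts)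
    (hrep : ∀ i, Rep (c.tapes (TapeId.work i)) (ts (TapeId.work i)) (hs i)) :
    N.toOracleTM.step φ c =
      { state := State.ctrl (SimState.right (N.next q ts).1 (N.next q ts).2.2)
        tapes := fun i => match i with
          | TapeId.work k => (c.tapes (TapeId.work k)).act
              (visited (isFirst (c.tapes (TapeId.work k)).read)
                ((N.next q ts).2.1 (TapeId.work k)).1, ((N.next q ts).2.1 (TapeId.work k)).2)
          | j => (c.tapes j).act
              (((N.next q ts).2.1 j).1.map Sum.inl, ((N.next q ts).2.1 j).2) } := by
  rw [← simNext_eq hraw hrep]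
  simp only [OracleTM.step, hc]
  congr 1
  funext i
  cases i <;> rfl

variable [Fintype N.ι]

/-- The hypothesis `next` is a continuation: it bounds the time from the end of the phase to the
goal, so that phases are chained by adding bounds. The extra `1` is the step that finds all flags
reached and leaves the phase. -/
theorem reachesIn_left
    (next : ∀ c : N.toOracleTM.Cfg, c.state = SimState.enter s → RawEq c.tapes ts →
      (∀ i, Rep (c.tapes (TapeId.work i)) (ts (TapeId.work i)) (hs i)) →
      ReachesIn (N.toOracleTM.step φ) G c B)
    (m : ℕ) (c : N.toOracleTM.Cfg) (hc : c.state = State.ctrl (SimState.left s k))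
    (hraw : RawEq c.tapes ts)
    (hinv : ∀ i, LeftInv (k i) (c.tapes (TapeId.work i)) (ts (TapeId.work i)) (hs i))
    (hm : ∑ i, leftCost (k i) (c.tapes (TapeId.work i)).pos ≤ m) :
    ReachesIn (N.toOracleTM.step φ) G c (B + m + 1) := by
  induction m using Nat.strong_induction_on generalizing c with
  | _ m ih =>
    apply ReachesIn.of_step
    by_cases hd : ∀ i, k i ≠ Post.keep → isFirst (c.tapes (TapeId.work i)).read = true
    · rw [step_left hc, if_pos hd]
      exact ReachesIn.mono (next _ rfl hraw fun i => (hinv i).rep (hd i)) (by omega)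
    · rw [step_left hc, if_neg hd]
      push Not at hd
      obtain ⟨i₀, hk, hf⟩ := hd
      have hlt : ∑ i, leftCost (k i) ((c.tapes (TapeId.work i)).act
          (leftAct (k i) (c.tapes (TapeId.work i)).read)).pos <
            ∑ i, leftCost (k i) (c.tapes (TapeId.work i)).pos :=
        Finset.sum_lt_sum (fun i _ => (hinv i).step.2.1)
          ⟨i₀, Finset.mem_univ _, (hinv i₀).step.2.2 hk (by simpa using hf)⟩
      exact ReachesIn.mono (ih (m - 1) (by omega) _ rfl hraw (fun i => (hinv i).step.1)
        (Nat.le_sub_one_of_lt (lt_of_lt_of_le hlt hm))) (by omega)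

theorem reachesIn_right
    (next : ∀ c : N.toOracleTM.Cfg, c.state = SimState.enter s → RawEq c.tapes ts →
      (∀ i, Rep (c.tapes (TapeId.work i)) (ts (TapeId.work i)) (finalExtent (k i) (hs i))) →
      ReachesIn (N.toOracleTM.step φ) G c B)
    (m : ℕ) (c : N.toOracleTM.Cfg) (hc : c.state = State.ctrl (SimState.right s k))
    (hraw : RawEq c.tapes ts)
    (hinv : ∀ i, RightInv (k i) (c.tapes (TapeId.work i)) (ts (TapeId.work i)) (hs i))
    (hm : ∑ i, rightCost (k i) (c.tapes (TapeId.work i)).pos (hs i) ≤ m) :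
    ReachesIn (N.toOracleTM.step φ) G c (B + m + 2) := by
  induction m using Nat.strong_induction_on generalizing c with
  | _ m ih =>
    apply ReachesIn.of_step
    by_cases hd : ∀ i, k i = Post.reset → (c.tapes (TapeId.work i)).read = Symbol.blank
    · rw [step_right hc, if_pos hd]
      refine reachesIn_left next m _ rfl hraw (fun i => ((hinv i).left (hd i)).1) ?_
      exact (Finset.sum_le_sum fun i _ => ((hinv i).left (hd i)).2).trans hm
    · rw [step_right hc, if_neg hd]
      push Not at hd
      obtain ⟨i₀, hk, hf⟩ := hd
      have hlt : ∑ i, rightCost (k i) ((c.tapes (TapeId.work i)).act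
          (rightAct (k i) (c.tapes (TapeId.work i)).read)).pos (hs i) <
            ∑ i, rightCost (k i) (c.tapes (TapeId.work i)).pos (hs i) :=
        Finset.sum_lt_sum (fun i _ => (hinv i).step.2.1)
          ⟨i₀, Finset.mem_univ _, (hinv i₀).step.2.2 hk hf⟩
      exact ReachesIn.mono (ih (m - 1) (by omega) _ rfl hraw (fun i => (hinv i).step.1)
        (Nat.le_sub_one_of_lt (lt_of_lt_of_le hlt hm))) (by omega)

/-- The bound is the current potential plus a constant for each remaining step. An ordinary action
raises the potential of a tape by at most `3` (one new cell, one move), and the sweep adds the slack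
`2`. The summand `3` counts the action itself and the last step of each of the two phases. -/
theorem reachesIn_of_iterate_halt {w : List Bool} (r : ℕ) (c : N.toOracleTM.Cfg) (d : N.Cfg)
    (hs : N.ι → ℕ) (hc : c.state = SimState.enter d.state) (hraw : RawEq c.tapes d.tapes)
    (hrep : ∀ i, Rep (c.tapes (TapeId.work i)) (d.tapes (TapeId.work i)) (hs i))
    (hd : N.Outputs w ((N.step φ)^[r] d)) :
    ReachesIn (N.toOracleTM.step φ) (N.toOracleTM.Outputs w) c
      (∑ i, potential (d.tapes (TapeId.work i)) (hs i) +
        (3 + 5 * Fintype.card N.ι) * r) := by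
  induction r generalizing c d hs with
  | zero =>
    refine ReachesIn.of_holds ⟨?_, ?_⟩
    · rw [hc, show d.state = State.halt from hd.1]
      rfl
    · have := hraw.2.1
      rw [this]
      exact (Tape.content_map _ _).trans hd.2
  | succ r ih =>
    rw [Function.iterate_succ_apply] at hd
    cases hds : d.state with
    | halt =>
      have e : N.step φ d = d := by simp [step, hds]
      rw [e] at hd
      exact (ih c d hs hc hraw hrep hd).mono (by rw [mul_add]; omega)
    | query =>
      rw [hds] at hc
      have hraw' : RawEq (N.toOracleTM.step φ c).tapes (N.step φ d).tapes := by
        obtain ⟨h1, h2, h3⟩ := hraw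
        refine ⟨?_, ?_, ?_⟩
        · simpa [OracleTM.step, step, hc, hds, SimState.enter] using h1
        · simpa [OracleTM.step, step, hc, hds, SimState.enter] using h2
        · simp [OracleTM.step, step, hc, hds, SimState.enter, h3]
      have hw : ∀ i, (N.step φ d).tapes (TapeId.work i) = d.tapes (TapeId.work i) := by
        simp [step, hds]
      have hw' : ∀ i, (N.toOracleTM.step φ c).tapes (TapeId.work i) =
          c.tapes (TapeId.work i) := by
        simp [OracleTM.step, hc, SimState.enter]
      refine ReachesIn.mono (ReachesIn.of_step
        (ih _ _ hs ?_ hraw' (fun i => by rw [hw, hw']; exact hrep i) hd)) ?_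
      · simp [OracleTM.step, step, hc, hds, SimState.enter]
      · simp only [hw, mul_add]
        omega
    | ctrl q =>
      rw [hds] at hc
      choose hs' hle hrep' using fun i =>
        (hrep i).act ((N.next q d.tapes).2.1 (TapeId.work i))
      refine ReachesIn.mono (ReachesIn.of_step (B := ∑ i, potential
          ((N.step φ d).tapes (TapeId.work i))
          (finalExtent ((N.next q d.tapes).2.2 i) (hs' i)) +
          (3 + 5 * Fintype.card N.ι) * r + ∑ i, rightCost ((N.next q d.tapes).2.2 i)
            ((c.tapes (TapeId.work i)).act (visited (isFirst (c.tapes (TapeId.work i)).read)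
                ((N.next q d.tapes).2.1 (TapeId.work i)).1,
                  ((N.next q d.tapes).2.1 (TapeId.work i)).2)).pos (hs' i) + 2) ?_) ?_
      · rw [step_run hc hraw hrep]
        refine reachesIn_right (ts := (N.step φ d).tapes) (hs := hs') ?_ _ _ rfl ?_ ?_ ?_
        · intro c' hc' hraw' hrep''
          exact ih c' _ _ (by rw [hc']; simp [step, hds]) hraw' hrep'' hd
        · obtain ⟨h1, h2, h3⟩ := hraw
          refine ⟨?_, ?_, ?_⟩ <;> simp [step, hds, h1, h2, h3]
        · intro i
          simpa [step, hds] using RightInv.of_rep (hrep' i)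
        · exact le_rfl
      · have key : ∀ i, rightCost ((N.next q d.tapes).2.2 i)
            ((c.tapes (TapeId.work i)).act (visited (isFirst (c.tapes (TapeId.work i)).read)
                ((N.next q d.tapes).2.1 (TapeId.work i)).1,
                  ((N.next q d.tapes).2.1 (TapeId.work i)).2)).pos (hs' i) +
            potential ((N.step φ d).tapes (TapeId.work i))
              (finalExtent ((N.next q d.tapes).2.2 i) (hs' i)) ≤
            potential (d.tapes (TapeId.work i)) (hs i) + 5 := by
          intro i
          have h1 := rightCost_add_potential_le (k := (N.next q d.tapes).2.2 i) (hrep' i)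
          have h2 : potential ((d.tapes (TapeId.work i)).act
              ((N.next q d.tapes).2.1 (TapeId.work i))) (hs' i) ≤
              potential (d.tapes (TapeId.work i)) (hs i) + 3 := by
            have h3 : ((d.tapes (TapeId.work i)).act
              ((N.next q d.tapes).2.1 (TapeId.work i))).pos ≤
                (d.tapes (TapeId.work i)).pos + 1 := by
              rcases (N.next q d.tapes).2.1 (TapeId.work i) with ⟨x, m⟩
              cases m <;> simp
              omega
            have := hle i
            simp only [potential]
            omega
          have h3 : (N.step φ d).tapes (TapeId.work i) = ((N.next q d.tapes).2.2 i).apply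
              ((d.tapes (TapeId.work i)).act ((N.next q d.tapes).2.1 (TapeId.work i))) := by
            simp [step, hds]
          rw [h3]
          omega
        have := Finset.sum_le_sum fun i (_ : i ∈ Finset.univ) => key i
        simp only [Finset.sum_add_distrib, Finset.sum_const, Finset.card_univ, smul_eq_mul] at this
        simp only [mul_add, add_mul] at this ⊢
        omega

end ResetTM

/-- Machines with rewinding and wiping are simulated by oracle Turing machines with constant
overhead. -/
theorem ResetTM.exists_oracleTM (N : ResetTM) : ∃ (M : OracleTM) (C : ℕ),
    ∀ (φ : Baire) (a w : List Bool) (B : ℕ),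
      ReachesIn (N.step φ) (N.Outputs w) (N.init a) B →
        ReachesIn (M.step φ) (M.Outputs w) (M.init a) (C * (B + 1)) := by
  have := N.finite_ι
  have := Fintype.ofFinite N.ι
  -- The setup step and the initial potential, `2` for each work tape, are absorbed by the `+ 1` in
  -- `B + 1`.
  refine ⟨N.toOracleTM, 4 + 5 * Fintype.card N.ι, ?_⟩
  rintro φ a w B ⟨n, hn, h⟩
  refine ReachesIn.mono (ReachesIn.of_step
    (ResetTM.reachesIn_of_iterate_halt n _ (N.init a) (fun _ => 1) ?_ ?_ ?_ h)) ?_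
  · rfl
  · refine ⟨?_, ?_, ?_⟩ <;> simp only [ResetTM.init, OracleTM.step, OracleTM.init,
      ResetTM.toOracleTM, Tape.map_ofString, Tape.act_read_stay]
  · intro i
    have e : (N.toOracleTM.step φ (N.toOracleTM.init a)).tapes (TapeId.work i) =
      (Tape.ofString [] 0).act (ResetTM.visited true Symbol.blank, Move.stay) := rfl
    rw [e]
    refine ⟨rfl, Nat.zero_le _, le_rfl, fun j hj => ?_, fun j hj => ⟨?_, rfl⟩⟩
    · obtain rfl : j = 0 := by omega
      rfl
    · rw [Tape.act_cells, if_neg (by simp; omega)]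
      rfl
  · simp only [ResetTM.potential, ResetTM.init, Tape.ofString_pos, Finset.sum_const,
      Finset.card_univ, smul_eq_mul]
    nlinarith

/-! ### Words on tapes -/

theorem getElem?_bitsPrefix {Γ : Type} (l : List (Symbol Γ)) :
    (∀ (i : ℕ) (h : i < (bitsPrefix l).length), l[i]? = some (Symbol.bit (bitsPrefix l)[i])) ∧
      ∀ b, l[(bitsPrefix l).length]? ≠ some (Symbol.bit b) := by
  induction l with
  | nil => simp [bitsPrefix]
  | cons s l ih =>
    cases s with
    | bit b =>
      refine ⟨fun i h => ?_, fun c => ?_⟩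
      · cases i with
        | zero => rfl
        | succ i => simpa [bitsPrefix] using ih.1 i (by simpa [bitsPrefix] using h)
      · simpa [bitsPrefix] using ih.2 c
    | blank => simp [bitsPrefix]
    | aux g => simp [bitsPrefix]

theorem bitsPrefix_append_blank {Γ : Type} (l l' : List (Symbol Γ)) :
    bitsPrefix (l ++ Symbol.blank :: l') = bitsPrefix l := by
  induction l with
  | nil => rfl
  | cons s l ih => cases s <;> simp [bitsPrefix, ih]

namespace Tape

variable {Γ : Type}

theorem movePos_le (m : Move) (p : ℕ) : movePos m p ≤ p + 1 := by
  cases m <;> grind [movePos]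

theorem act_pos_le (t : Tape Γ) (x : Symbol Γ × Move) : (t.act x).pos ≤ t.pos + 1 :=
  (act_pos t x.1 x.2).trans_le (movePos_le _ _)

/-- The letters at the beginning of the tape, irrespective of the head position, spell `w`. -/
structure Spells (t : Tape Γ) (w : List Bool) : Prop where
  bit : ∀ (i : ℕ) (h : i < w.length), t.cells i = Symbol.bit w[i]
  not_bit : ∀ b, t.cells w.length ≠ Symbol.bit b

theorem Spells.congr {t u : Tape Γ} {w : List Bool} (h : t.Spells w) (hc : u.cells = t.cells) :
    u.Spells w :=
  ⟨by rw [hc]; exact h.bit, by rw [hc]; exact h.not_bit⟩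

/-- The content is delimited by the head position. A blank written there delimits it on the tape
itself, so the word can still be recovered once the head has moved back. -/
theorem spells_act_blank (t : Tape Γ) (m : Move) :
    (t.act (Symbol.blank, m)).Spells t.content := by
  have hle := t.length_content_le
  obtain ⟨h1, h2⟩ := getElem?_bitsPrefix ((List.range t.pos).map t.cells)
  change ∀ (i : ℕ) (h : i < t.content.length), _ = some (Symbol.bit t.content[i]) at h1
  change ∀ b, _[t.content.length]? ≠ _ at h2
  refine ⟨fun i h => ?_, fun b => ?_⟩
  · have := h1 i h
    rw [act_cells, if_neg (by omega)]
    simpa [show i < t.pos by omega] using this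
  · rw [act_cells]
    split_ifs with hp
    · simp
    · have := h2 b
      simpa [show t.content.length < t.pos by omega] using this

/-- This is why `cont` may stop at the end of a short answer: whatever lies beyond a blank cannot
belong to the next query. -/
theorem content_eq_of_blank (t : Tape Γ) {n : ℕ} (hn : n ≤ t.pos)
    (hb : t.cells n = Symbol.blank) :
    t.content = ({ t with pos := n } : Tape Γ).content := by
  rcases hn.eq_or_lt with rfl | hlt
  · rfl
  · unfold content
    obtain ⟨k, hk⟩ := Nat.exists_eq_add_of_lt hlt
    rw [hk, Nat.add_assoc, List.range_add, List.map_append, Nat.add_comm k 1, List.range_add]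
    simp [hb, bitsPrefix_append_blank]

theorem ofString_take_act (w : List Bool) {i : ℕ} (h : i < w.length) :
    (ofString (w.take i) i : Tape Γ).act (Symbol.bit w[i], Move.right) =
      ofString (w.take (i + 1)) (i + 1) := by
  ext j
  · rw [act_cells]
    rcases lt_trichotomy j i with hj | rfl | hj
    · rw [if_neg (by simpa using hj.ne)]
      simp [ofString, List.getElem?_take, hj, hj.le]
    · simp [ofString, h]
    · rw [if_neg (by simpa using hj.ne'), ofString_cells_ge, ofString_cells_ge] <;> simp <;> omega
  · rfl

theorem ofString_act_right (w : List Bool) (i : ℕ) :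
    (ofString w i : Tape Γ).act ((ofString w i : Tape Γ).read, Move.right) =
      ofString w (i + 1) := by
  ext j
  · rw [act_read_cells]; rfl
  · rfl

end Tape

/-! ### The query tape of the outer machine -/

/-- Auxiliary symbols of the composed machine. -/
abbrev CompSymbol (Γ Δ : Type) : Type := Γ ⊕ Δ ⊕ Symbol Γ

/-- The tapes that represent the query tape of the outer machine. Let `w` be the last answer.
`base` holds `w`. `cont` has the same head position, and left of the head the current content.
`disp` stores by how far the head of the query tape is further to the right. `pos` and `neg` form
a two-sided tape that holds the cells visited since the last query. -/
inductive Reg : Type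
  | cont : Reg
  | disp : Reg
  | pos : Reg
  | neg : Reg
  | base : Reg

instance : Finite Reg :=
  Finite.of_injective
    (fun s : Reg => match s with
      | Reg.cont => (0 : Fin 5)
      | Reg.disp => 1
      | Reg.pos => 2
      | Reg.neg => 3
      | Reg.base => 4)
    (by intro a b; cases a <;> cases b <;> simp)

section QueryTape

variable {Γ Δ : Type}

/-- The symbol for a visited cell. -/
def mark (s : Symbol Γ) : Symbol (CompSymbol Γ Δ) := Symbol.aux (Sum.inr (Sum.inr s))

/-- The symbol of a cell, given its marking and the symbol from the last answer. -/
noncomputable def overlay (o d : Symbol (CompSymbol Γ Δ)) : Symbol Γ :=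
  match o with
  | Symbol.aux (Sum.inr (Sum.inr s)) => s
  | _ => Symbol.unmap Sum.inl d

@[simp] theorem overlay_mark (s : Symbol Γ) (d : Symbol (CompSymbol Γ Δ)) :
    overlay (mark s) d = s := rfl

@[simp] theorem overlay_blank (s : Symbol Γ) :
    overlay Symbol.blank (s.map Sum.inl : Symbol (CompSymbol Γ Δ)) = s :=
  Symbol.unmap_map Sum.inl_injective s

/-- The symbol under the head of the query tape. -/
noncomputable def queryRead (rd : Reg → Symbol (CompSymbol Γ Δ)) (z : Reg → Bool) : Symbol Γ :=
  overlay (if z Reg.neg then rd Reg.pos else rd Reg.neg) (rd Reg.base)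

/-- The opposite move. -/
def Move.opp : Move → Move
  | Move.left => Move.right
  | Move.stay => Move.stay
  | Move.right => Move.left

/-- The move of the head of the query tape, which cannot move left on the first cell. -/
def queryMove (z : Reg → Bool) : Move → Move
  | Move.left => if z Reg.cont && z Reg.disp then Move.stay else Move.left
  | m => m

/-- The actions that simulate an action on the query tape. -/
def queryAct (rd : Reg → Symbol (CompSymbol Γ Δ)) (z : Reg → Bool) (x : Symbol Γ × Move) :
    Reg → Symbol (CompSymbol Γ Δ) × Move
  | Reg.cont => if z Reg.disp then (x.1.map Sum.inl, queryMove z x.2)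
      else (rd Reg.cont, Move.stay)
  | Reg.base => (rd Reg.base, if z Reg.disp then queryMove z x.2 else Move.stay)
  | Reg.disp => (rd Reg.disp, if z Reg.disp then Move.stay else queryMove z x.2)
  | Reg.pos => if z Reg.neg then
      (mark x.1, match queryMove z x.2 with
        | Move.left => if z Reg.pos then Move.stay else Move.left
        | m => m)
      else (rd Reg.pos, Move.stay)
  | Reg.neg => if z Reg.neg then
      (rd Reg.neg, match queryMove z x.2 with
        | Move.left => if z Reg.pos then Move.right else Move.stay
        | _ => Move.stay)
      else (mark x.1, (queryMove z x.2).opp)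

/-- The tapes `R` represent the query tape `X`, where `w` is the last answer and `p₀` the head
position at the last query. -/
structure QueryRep (R : Reg → Tape (CompSymbol Γ Δ)) (X : Tape Γ) (w : List Bool) (p₀ : ℕ) :
    Prop where
  base_eq : R Reg.base = Tape.ofString w (R Reg.cont).pos
  pos_add : (R Reg.cont).pos + (R Reg.disp).pos = X.pos
  cont_eq : ∀ i < (R Reg.cont).pos, (R Reg.cont).cells i = (X.cells i).map Sum.inl
  far : 0 < (R Reg.disp).pos → (R Reg.cont).pos = w.length ∧ X.cells w.length = Symbol.blank
  center : X.pos + (R Reg.neg).pos = p₀ + (R Reg.pos).pos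
  side : (R Reg.neg).pos = 0 ∨ (R Reg.pos).pos = 0
  right_cells : ∀ j, X.cells (p₀ + j) =
    overlay ((R Reg.pos).cells j) ((Tape.ofString w 0 : Tape (CompSymbol Γ Δ)).cells (p₀ + j))
  left_cells : ∀ j, 1 ≤ j → j ≤ p₀ → X.cells (p₀ - j) =
    overlay ((R Reg.neg).cells j) ((Tape.ofString w 0 : Tape (CompSymbol Γ Δ)).cells (p₀ - j))

variable {R : Reg → Tape (CompSymbol Γ Δ)} {X : Tape Γ} {w : List Bool} {p₀ : ℕ}

/-- Which heads are on the first cell. -/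
def zeros (R : Reg → Tape (CompSymbol Γ Δ)) (r : Reg) : Bool := decide ((R r).pos = 0)

theorem QueryRep.of_answer {p : ℕ} (h1 : R Reg.base = Tape.ofString w (R Reg.cont).pos)
    (h2 : (R Reg.cont).pos + (R Reg.disp).pos = p)
    (h3 : ∀ i < (R Reg.cont).pos, (R Reg.cont).cells i = (Tape.ofString w 0).cells i)
    (h4 : 0 < (R Reg.disp).pos → (R Reg.cont).pos = w.length)
    (h5 : R Reg.pos = Tape.ofString [] 0) (h6 : R Reg.neg = Tape.ofString [] 0) :
    QueryRep R (Tape.ofString w p) w p := by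
  have e : ∀ i, (Tape.ofString w 0 : Tape (CompSymbol Γ Δ)).cells i =
      ((Tape.ofString w p : Tape Γ).cells i).map Sum.inl := fun i => by
    rw [← Tape.map_cells, Tape.map_ofString]
    rfl
  refine ⟨h1, h2, fun i hi => ?_, fun h => ⟨h4 h, ?_⟩, ?_, ?_, fun j => ?_, fun j _ _ => ?_⟩
  · rw [h3 i hi, e]
  · exact Tape.ofString_cells_ge _ _ le_rfl
  · simp [h5, h6]
  · simp [h5]
  · rw [h5, e, Tape.ofString_nil_cells, overlay_blank]
  · rw [h6, e, Tape.ofString_nil_cells, overlay_blank]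

/-- With nonzero displacement the head of `base` is not at the true position, but both positions are
at or beyond the end of `w` and hence blank there. -/
theorem QueryRep.base_read (r : QueryRep R X w p₀) : (R Reg.base).read =
    (Tape.ofString w 0 : Tape (CompSymbol Γ Δ)).cells X.pos := by
  rw [r.base_eq, Tape.read, Tape.ofString_pos]
  have h := r.pos_add
  rcases Nat.eq_zero_or_pos (R Reg.disp).pos with h0 | h0
  · rw [← h, h0]
    rfl
  · have := (r.far h0).1
    rw [Tape.ofString_cells_ge _ _ (by omega), Tape.ofString_cells_ge _ _ (by omega)]

theorem QueryRep.read (r : QueryRep R X w p₀) :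
    queryRead (fun i => (R i).read) (zeros R) = X.read := by
  have hc := r.center
  have hs := r.side
  rw [queryRead, r.base_read]
  by_cases hn : (R Reg.neg).pos = 0
  · simp only [zeros, hn, decide_true, if_true]
    have e : X.pos = p₀ + (R Reg.pos).pos := by omega
    rw [Tape.read, Tape.read, e, r.right_cells]
  · simp only [zeros, hn, decide_false, Bool.false_eq_true, if_false]
    have e : X.pos = p₀ - (R Reg.neg).pos := by omega
    rw [Tape.read, Tape.read, e, r.left_cells _ (by omega) (by omega)]

theorem QueryRep.content (r : QueryRep R X w p₀) : (R Reg.cont).content = X.content := by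
  have h := r.pos_add
  have hX : ({ X with pos := (R Reg.cont).pos } : Tape Γ).content = X.content := by
    rcases Nat.eq_zero_or_pos (R Reg.disp).pos with h0 | h0
    · rw [← Nat.add_zero (R Reg.cont).pos, ← h0, h]
    · rw [(r.far h0).1, ← X.content_eq_of_blank (by have := (r.far h0).1; omega) (r.far h0).2]
  rw [← hX, ← Tape.content_map (Sum.inl : Γ → CompSymbol Γ Δ)]
  exact Tape.content_congr rfl r.cont_eq

/-- `cont` has to be correct only left of its head, and a head moving right has just written the
cell it leaves. While the displacement is nonzero, the true head is right of cell `w.length`, so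
this cell stays blank, and the displacement vanishes exactly when the head returns to it. On the
two-sided tape only one half moves at a time, and the roles change at the centre `p₀`. -/
theorem QueryRep.act (r : QueryRep R X w p₀) (x : Symbol Γ × Move) :
    QueryRep (fun i => (R i).act (queryAct (fun i => (R i).read) (zeros R) x i)) (X.act x)
      w p₀ := by
  obtain ⟨s, m⟩ := x
  obtain ⟨h1, h2, h3, h4, h5, h6, h7, h8⟩ := r
  have hbase : ∀ y, (R Reg.base).act ((R Reg.base).read, y) =
      Tape.ofString w (Tape.movePos y (R Reg.cont).pos) := by
    intro y
    rw [h1]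
    ext j
    · rw [Tape.act_read_cells]; rfl
    · rw [Tape.act_pos]; rfl
  refine ⟨?_, ?_, ?_, ?_, ?_, ?_, ?_, ?_⟩
  · simp only [queryAct, zeros, hbase]
    by_cases hd : (R Reg.disp).pos = 0 <;> simp [hd, Tape.act_pos, Tape.movePos]
  · by_cases hd : (R Reg.disp).pos = 0 <;> by_cases hc : (R Reg.cont).pos = 0 <;> cases m <;>
      simp [queryAct, zeros, queryMove, hd, hc] <;> omega
  · intro i hi
    by_cases hd : (R Reg.disp).pos = 0
    · simp only [queryAct, zeros, hd, decide_true, if_true, Tape.act_cells] at hi ⊢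
      by_cases hj : i = (R Reg.cont).pos
      · rw [if_pos hj, if_pos (by omega)]
      · rw [if_neg hj, if_neg (by omega)]
        refine h3 i ?_
        have := Tape.movePos_le (queryMove (zeros R) m) (R Reg.cont).pos
        rw [Tape.act_pos] at hi
        exact lt_of_le_of_ne (Nat.le_of_lt_succ (hi.trans_le this)) hj
    · simp only [queryAct, zeros, hd, decide_false, Bool.false_eq_true, if_false,
        Tape.act_read_stay, Tape.act_cells] at hi ⊢
      rw [if_neg (by omega), h3 i hi]
  · by_cases hd : (R Reg.disp).pos = 0
    · simp [queryAct, zeros, hd]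
    · have := (h4 (by omega)).1
      simp only [queryAct, zeros, hd, decide_false, Bool.false_eq_true, if_false,
        Tape.act_read_stay, Tape.act_cells]
      rw [if_neg (by omega)]
      exact fun _ => h4 (by omega)
  · by_cases hd : (R Reg.disp).pos = 0 <;> by_cases hc : (R Reg.cont).pos = 0 <;>
      by_cases hn : (R Reg.neg).pos = 0 <;> by_cases hp : (R Reg.pos).pos = 0 <;> cases m <;>
      simp [queryAct, zeros, queryMove, hd, hc, hn, hp, Move.opp] <;> omega
  · by_cases hd : (R Reg.disp).pos = 0 <;> by_cases hc : (R Reg.cont).pos = 0 <;>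
      by_cases hn : (R Reg.neg).pos = 0 <;> by_cases hp : (R Reg.pos).pos = 0 <;> cases m <;>
      simp [queryAct, zeros, queryMove, hd, hc, hn, hp, Move.opp] <;> omega
  · intro j
    by_cases hn : (R Reg.neg).pos = 0
    · simp only [queryAct, zeros, hn, decide_true, if_true, Tape.act_cells]
      by_cases hj : j = (R Reg.pos).pos
      · rw [if_pos (by omega), if_pos hj, overlay_mark]
      · rw [if_neg (by omega), if_neg hj, h7]
    · simp only [queryAct, zeros, hn, decide_false, Bool.false_eq_true, if_false,
        Tape.act_read_stay, Tape.act_cells]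
      rw [if_neg (by omega), h7]
  · intro j hj1 hj2
    by_cases hn : (R Reg.neg).pos = 0
    · simp only [queryAct, zeros, hn, decide_true, if_true, Tape.act_read_cells]
      rw [Tape.act_cells, if_neg (by omega), h8 j hj1 hj2]
    · simp only [queryAct, zeros, hn, decide_false, Bool.false_eq_true, if_false,
        Tape.act_cells]
      by_cases hj : j = (R Reg.neg).pos
      · rw [if_pos (by omega), if_pos hj, overlay_mark]
      · rw [if_neg (by omega), if_neg hj, h8 j hj1 hj2]

end QueryTape

/-! ### The composed machine -/

/-- Families indexed by the tapes of the composed machine: the tapes `inp`, `out`, `qry` proper,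
the work tapes `f` of the outer machine, the tapes `gi`, `go`, `gq`, `gw` of the inner machine,
and the tapes that represent the query tape of the outer machine. -/
structure Bundle (ι κ A : Type) : Type where
  inp : A
  out : A
  qry : A
  f : ι → A
  gi : A
  go : A
  gq : A
  gw : κ → A
  cont : A
  disp : A
  pos : A
  neg : A
  base : A

namespace Bundle

variable {ι κ A B : Type}

/-- Indices of the work tapes of the composed machine. -/
abbrev Idx (ι κ : Type) : Type := ι ⊕ TapeId κ ⊕ Reg

/-- The entries for the query tape of the outer machine. -/
def reg (T : Bundle ι κ A) : Reg → A
  | Reg.cont => T.cont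
  | Reg.disp => T.disp
  | Reg.pos => T.pos
  | Reg.neg => T.neg
  | Reg.base => T.base

/-- The entries for the inner machine. -/
def inner (T : Bundle ι κ A) : TapeId κ → A
  | TapeId.input => T.gi
  | TapeId.output => T.go
  | TapeId.query => T.gq
  | TapeId.work k => T.gw k

/-- The entries for the work tapes. -/
def work (T : Bundle ι κ A) : Idx ι κ → A
  | Sum.inl k => T.f k
  | Sum.inr (Sum.inl i) => T.inner i
  | Sum.inr (Sum.inr r) => T.reg r

/-- The family as a function. -/
def toFun (T : Bundle ι κ A) : TapeId (Idx ι κ) → A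
  | TapeId.input => T.inp
  | TapeId.output => T.out
  | TapeId.query => T.qry
  | TapeId.work k => T.work k

/-- The family given by a function. -/
def ofFun (t : TapeId (Idx ι κ) → A) : Bundle ι κ A where
  inp := t TapeId.input
  out := t TapeId.output
  qry := t TapeId.query
  f k := t (TapeId.work (Sum.inl k))
  gi := t (TapeId.work (Sum.inr (Sum.inl TapeId.input)))
  go := t (TapeId.work (Sum.inr (Sum.inl TapeId.output)))
  gq := t (TapeId.work (Sum.inr (Sum.inl TapeId.query)))
  gw k := t (TapeId.work (Sum.inr (Sum.inl (TapeId.work k))))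
  cont := t (TapeId.work (Sum.inr (Sum.inr Reg.cont)))
  disp := t (TapeId.work (Sum.inr (Sum.inr Reg.disp)))
  pos := t (TapeId.work (Sum.inr (Sum.inr Reg.pos)))
  neg := t (TapeId.work (Sum.inr (Sum.inr Reg.neg)))
  base := t (TapeId.work (Sum.inr (Sum.inr Reg.base)))

/-- The entrywise image. -/
def map (h : A → B) (T : Bundle ι κ A) : Bundle ι κ B := ofFun fun i => h (T.toFun i)

/-- The constant family. -/
def const (a : A) : Bundle ι κ A := ofFun fun _ => a

end Bundle

/-- Control states of the composed machine. -/
inductive CompState (P Q : Type) : Type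
  | outer : P → CompState P Q
  | ask : CompState P Q
  | back : CompState P Q
  | load : CompState P Q
  | inner : Q → Bool → CompState P Q
  | done : CompState P Q
  | rewind : CompState P Q
  | copy : CompState P Q
  | place : CompState P Q

instance {P Q : Type} [Finite P] [Finite Q] : Finite (CompState P Q) :=
  Finite.of_injective
    (fun s : CompState P Q => match s with
      | CompState.outer q => (Sum.inl q : P ⊕ (Q × Bool) ⊕ Fin 7)
      | CompState.inner q b => Sum.inr (Sum.inl (q, b))
      | CompState.ask => Sum.inr (Sum.inr 0)
      | CompState.back => Sum.inr (Sum.inr 1)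
      | CompState.load => Sum.inr (Sum.inr 2)
      | CompState.done => Sum.inr (Sum.inr 3)
      | CompState.rewind => Sum.inr (Sum.inr 4)
      | CompState.copy => Sum.inr (Sum.inr 5)
      | CompState.place => Sum.inr (Sum.inr 6))
    (by intro a b; cases a <;> cases b <;> simp)

/-- The state of the composed machine for a state of the outer machine. -/
def CompState.ofOuter {P Q : Type} : State P → State (CompState P Q)
  | State.halt => State.halt
  | State.query => State.ctrl CompState.ask
  | State.ctrl q => State.ctrl (CompState.outer q)

/-- The state of the composed machine for a state of the inner machine. The flag tells whether
the inner machine has asked a query. -/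
def CompState.ofInner {P Q : Type} (asked : Bool) : State Q → State (CompState P Q)
  | State.halt => State.ctrl CompState.done
  | State.query => State.query
  | State.ctrl q => State.ctrl (CompState.inner q asked)

namespace OracleTM

/-- The symbol of the inner machine. -/
abbrev innerSymbol {Γ Δ : Type} : Δ → CompSymbol Γ Δ := fun d => Sum.inr (Sum.inl d)

theorem innerSymbol_injective {Γ Δ : Type} :
    Function.Injective (innerSymbol : Δ → CompSymbol Γ Δ) :=
  Sum.inr_injective.comp Sum.inl_injective

variable (M₁ M₂ : OracleTM)

/-- The symbols read by the outer machine. -/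
noncomputable def outerRead
    (rd : Bundle M₁.ι M₂.ι (Symbol (CompSymbol M₁.Γ M₂.Γ))) (z : Reg → Bool) :
    TapeId M₁.ι → Symbol M₁.Γ
  | TapeId.input => Symbol.unmap Sum.inl rd.inp
  | TapeId.output => Symbol.unmap Sum.inl rd.out
  | TapeId.query => queryRead rd.reg z
  | TapeId.work k => Symbol.unmap Sum.inl (rd.f k)

/-- The symbols read by the inner machine. -/
noncomputable def innerRead (asked : Bool)
    (rd : Bundle M₁.ι M₂.ι (Symbol (CompSymbol M₁.Γ M₂.Γ))) : TapeId M₂.ι → Symbol M₂.Γ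
  | TapeId.query => Symbol.unmap innerSymbol (if asked then rd.qry else rd.gq)
  | i => Symbol.unmap innerSymbol (rd.inner i)

/-- Rename the symbol of an action. -/
def mapAct {Γ Δ : Type} (e : Γ → Δ) (x : Symbol Γ × Move) : Symbol Δ × Move := (x.1.map e, x.2)

/-- The transitions of the composed machine. -/
noncomputable def compTrans (q : CompState M₁.Q M₂.Q)
    (rd : Bundle M₁.ι M₂.ι (Symbol (CompSymbol M₁.Γ M₂.Γ))) (z : Bundle.Idx M₁.ι M₂.ι → Bool) :
    State (CompState M₁.Q M₂.Q) × Bundle M₁.ι M₂.ι (Symbol (CompSymbol M₁.Γ M₂.Γ) × Move) ×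
      Bundle M₁.ι M₂.ι Post :=
  let idle : Bundle M₁.ι M₂.ι (Symbol (CompSymbol M₁.Γ M₂.Γ) × Move) :=
    rd.map fun s => (s, Move.stay)
  let keep : Bundle M₁.ι M₂.ι Post := Bundle.const Post.keep
  let zr : Reg → Bool := fun r => z (Sum.inr (Sum.inr r))
  match q with
  | CompState.outer q =>
    let o := M₁.trans q (M₁.outerRead M₂ rd zr)
    let a := queryAct rd.reg zr (o.2 TapeId.query)
    (CompState.ofOuter o.1,
      { idle with
        inp := mapAct Sum.inl (o.2 TapeId.input)
        out := mapAct Sum.inl (o.2 TapeId.output)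
        f := fun k => mapAct Sum.inl (o.2 (TapeId.work k))
        cont := a Reg.cont
        disp := a Reg.disp
        pos := a Reg.pos
        neg := a Reg.neg
        base := a Reg.base }, keep)
  | CompState.ask =>
    (State.ctrl CompState.back,
      { idle with cont := (Symbol.blank, Move.stay) },
      { keep with
        gi := Post.reset
        go := Post.reset
        gq := Post.reset
        gw := fun _ => Post.reset
        pos := Post.reset
        neg := Post.reset
        base := Post.reset })
  | CompState.back =>
    if zr Reg.cont then (State.ctrl CompState.load, idle, keep)
    else (State.ctrl CompState.back,
      { idle with cont := (rd.cont, Move.left), disp := (rd.disp, Move.right) }, keep)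
  | CompState.load =>
    match rd.cont with
    | Symbol.bit b => (State.ctrl CompState.load,
        { idle with cont := (rd.cont, Move.right), gi := (Symbol.bit b, Move.right) }, keep)
    | _ => (CompState.ofInner false M₂.start, idle,
        { keep with gi := Post.home, cont := Post.reset })
  | CompState.inner q asked =>
    let o := M₂.trans q (M₁.innerRead M₂ asked rd)
    (CompState.ofInner asked o.1,
      { idle with
        qry := mapAct innerSymbol (o.2 TapeId.query)
        gi := mapAct innerSymbol (o.2 TapeId.input)
        go := mapAct innerSymbol (o.2 TapeId.output)
        gq := mapAct innerSymbol (o.2 TapeId.query)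
        gw := fun k => mapAct innerSymbol (o.2 (TapeId.work k)) }, keep)
  | CompState.done =>
    (State.ctrl CompState.rewind, { idle with go := (Symbol.blank, Move.stay) },
      { keep with go := Post.home })
  | CompState.rewind =>
    if z (Sum.inr (Sum.inl TapeId.query)) then (State.ctrl CompState.copy, idle, keep)
    else (State.ctrl CompState.rewind,
      { idle with qry := (rd.qry, Move.left), gq := (rd.gq, Move.left) }, keep)
  | CompState.copy =>
    match rd.go with
    | Symbol.bit b => (State.ctrl CompState.copy,
        { idle with go := (rd.go, Move.right), base := (Symbol.bit b, Move.right) }, keep)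
    | _ => (State.ctrl CompState.place, idle, { keep with go := Post.home, base := Post.home })
  | CompState.place =>
    match rd.go, zr Reg.disp with
    | Symbol.bit b, false => (State.ctrl CompState.place,
        { idle with
          go := (rd.go, Move.right)
          base := (rd.base, Move.right)
          cont := (Symbol.bit b, Move.right)
          disp := (rd.disp, Move.left) }, keep)
    | _, _ => (CompState.ofOuter M₁.answer, idle, keep)

/-- The composition of two machines: `M₁` is run, and its queries are answered by runs of `M₂`. -/
noncomputable abbrev comp : ResetTM where
  Γ := CompSymbol M₁.Γ M₂.Γ
  ι := Bundle.Idx M₁.ι M₂.ι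
  Q := CompState M₁.Q M₂.Q
  finite_Γ := by
    have := M₁.finite_Γ
    have := M₂.finite_Γ
    infer_instance
  finite_ι := by
    have := M₁.finite_ι
    have := M₂.finite_ι
    infer_instance
  finite_Q := by
    have := M₁.finite_Q
    have := M₂.finite_Q
    infer_instance
  start := CompState.ofOuter M₁.start
  answer := CompState.ofInner true M₂.answer
  trans q rd z :=
    let o := compTrans M₁ M₂ q (Bundle.ofFun rd) z
    (o.1, o.2.1.toFun, o.2.2.work)

/-- The tapes of the composed machine. -/
abbrev CompTapes : Type := Bundle M₁.ι M₂.ι (Tape (CompSymbol M₁.Γ M₂.Γ))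

variable {M₁ M₂}

/-- A configuration of the composed machine. -/
noncomputable def compCfg (s : State (CompState M₁.Q M₂.Q)) (T : CompTapes M₁ M₂) :
    (comp M₁ M₂).Cfg := ⟨s, T.toFun⟩

end OracleTM

/-! ### Single steps of the composed machine -/

namespace OracleTM

variable {M₁ M₂ : OracleTM} {φ : Baire} {T : CompTapes M₁ M₂}

/-- The tapes after the given actions and final operations. -/
def actTapes (T : CompTapes M₁ M₂)
    (a : Bundle M₁.ι M₂.ι (Symbol (CompSymbol M₁.Γ M₂.Γ) × Move))
    (p : Bundle M₁.ι M₂.ι Post) : CompTapes M₁ M₂ where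
  inp := T.inp.act a.inp
  out := T.out.act a.out
  qry := T.qry.act a.qry
  f k := (p.f k).apply ((T.f k).act (a.f k))
  gi := p.gi.apply (T.gi.act a.gi)
  go := p.go.apply (T.go.act a.go)
  gq := p.gq.apply (T.gq.act a.gq)
  gw k := (p.gw k).apply ((T.gw k).act (a.gw k))
  cont := p.cont.apply (T.cont.act a.cont)
  disp := p.disp.apply (T.disp.act a.disp)
  pos := p.pos.apply (T.pos.act a.pos)
  neg := p.neg.apply (T.neg.act a.neg)
  base := p.base.apply (T.base.act a.base)

/-- Reduces each of the following step lemmas to evaluating `compTrans`; the passage between bundles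
and indexed families is done here once. -/
theorem comp_step_ctrl {q : CompState M₁.Q M₂.Q} {s : State (CompState M₁.Q M₂.Q)}
    {a : Bundle M₁.ι M₂.ι (Symbol (CompSymbol M₁.Γ M₂.Γ) × Move)} {p : Bundle M₁.ι M₂.ι Post}
    (h : compTrans M₁ M₂ q (T.map Tape.read) (fun k => decide ((T.work k).pos = 0)) = (s, a, p)) :
    (comp M₁ M₂).step φ (compCfg (State.ctrl q) T) = compCfg s (actTapes T a p) := by
  have hn : (comp M₁ M₂).next q T.toFun = (s, a.toFun, p.work) := by
    change (fun o : State (CompState M₁.Q M₂.Q) ×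
      Bundle M₁.ι M₂.ι (Symbol (CompSymbol M₁.Γ M₂.Γ) × Move) × Bundle M₁.ι M₂.ι Post =>
        (o.1, o.2.1.toFun, o.2.2.work)) (compTrans M₁ M₂ q (T.map Tape.read)
          fun k => decide ((T.work k).pos = 0)) = _
    rw [h]
  simp only [ResetTM.step, compCfg, hn]
  refine congrArg (ResetTM.Cfg.mk _) (funext fun i => ?_)
  rcases i with _ | _ | _ | (_ | (_ | _ | _ | _) | (_ | _ | _ | _ | _)) <;> rfl

theorem comp_step_ask : (comp M₁ M₂).step φ (compCfg (State.ctrl CompState.ask) T) =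
    compCfg (State.ctrl CompState.back)
      { T with
        gi := Tape.ofString [] 0
        go := Tape.ofString [] 0
        gq := Tape.ofString [] 0
        gw := fun _ => Tape.ofString [] 0
        cont := T.cont.act (Symbol.blank, Move.stay)
        pos := Tape.ofString [] 0
        neg := Tape.ofString [] 0
        base := Tape.ofString [] 0 } := by
  rw [comp_step_ctrl rfl]
  simp [actTapes, Bundle.map, Bundle.ofFun, Bundle.toFun, Bundle.work, Bundle.inner, Bundle.reg,
    Bundle.const, Post.apply]

theorem comp_step_back_zero (h : T.cont.pos = 0) :
    (comp M₁ M₂).step φ (compCfg (State.ctrl CompState.back) T) =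
      compCfg (State.ctrl CompState.load) T := by
  rw [comp_step_ctrl (by
    simp only [compTrans]
    exact if_pos (by simp [Bundle.work, Bundle.reg, h]))]
  simp [actTapes, Bundle.map, Bundle.ofFun, Bundle.toFun, Bundle.work, Bundle.inner, Bundle.reg,
    Bundle.const, Post.apply]

theorem comp_step_back_pos (h : T.cont.pos ≠ 0) :
    (comp M₁ M₂).step φ (compCfg (State.ctrl CompState.back) T) =
      compCfg (State.ctrl CompState.back)
        { T with
          cont := T.cont.act (T.cont.read, Move.left)
          disp := T.disp.act (T.disp.read, Move.right) } := by
  rw [comp_step_ctrl (by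
    simp only [compTrans]
    exact if_neg (by simp [Bundle.work, Bundle.reg, h]))]
  simp [actTapes, Bundle.map, Bundle.ofFun, Bundle.toFun, Bundle.work, Bundle.inner, Bundle.reg,
    Bundle.const, Post.apply]

theorem comp_step_load_bit {b : Bool} (h : T.cont.read = Symbol.bit b) :
    (comp M₁ M₂).step φ (compCfg (State.ctrl CompState.load) T) =
      compCfg (State.ctrl CompState.load)
        { T with
          cont := T.cont.act (T.cont.read, Move.right)
          gi := T.gi.act (Symbol.bit b, Move.right) } := by
  rw [comp_step_ctrl (by
    simp only [compTrans]
    rw [show (T.map Tape.read).cont = Symbol.bit b from h])]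
  simp [actTapes, Bundle.map, Bundle.ofFun, Bundle.toFun, Bundle.work, Bundle.inner, Bundle.reg,
    Bundle.const, Post.apply, h]

theorem comp_step_load_stop (h : ∀ b, T.cont.read ≠ Symbol.bit b) :
    (comp M₁ M₂).step φ (compCfg (State.ctrl CompState.load) T) =
      compCfg (CompState.ofInner false M₂.start)
        { T with
          cont := Tape.ofString [] 0
          gi := { T.gi with pos := 0 } } := by
  rw [comp_step_ctrl (by
    simp only [compTrans]
    split
    · next heq => exact absurd heq (h _)
    · rfl)]
  simp [actTapes, Bundle.map, Bundle.ofFun, Bundle.toFun, Bundle.work, Bundle.inner, Bundle.reg,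
    Bundle.const, Post.apply]

theorem comp_step_done :
    (comp M₁ M₂).step φ (compCfg (State.ctrl CompState.done) T) =
      compCfg (State.ctrl CompState.rewind)
        { T with go := { T.go.act (Symbol.blank, Move.stay) with pos := 0 } } := by
  rw [comp_step_ctrl rfl]
  simp [actTapes, Bundle.map, Bundle.ofFun, Bundle.toFun, Bundle.work, Bundle.inner, Bundle.reg,
    Bundle.const, Post.apply]

theorem comp_step_rewind_zero (h : T.gq.pos = 0) :
    (comp M₁ M₂).step φ (compCfg (State.ctrl CompState.rewind) T) =
      compCfg (State.ctrl CompState.copy) T := by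
  rw [comp_step_ctrl (by
    simp only [compTrans]
    exact if_pos (by simp [Bundle.work, Bundle.inner, h]))]
  simp [actTapes, Bundle.map, Bundle.ofFun, Bundle.toFun, Bundle.work, Bundle.inner, Bundle.reg,
    Bundle.const, Post.apply]

theorem comp_step_rewind_pos (h : T.gq.pos ≠ 0) :
    (comp M₁ M₂).step φ (compCfg (State.ctrl CompState.rewind) T) =
      compCfg (State.ctrl CompState.rewind)
        { T with
          qry := T.qry.act (T.qry.read, Move.left)
          gq := T.gq.act (T.gq.read, Move.left) } := by
  rw [comp_step_ctrl (by
    simp only [compTrans]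
    exact if_neg (by simp [Bundle.work, Bundle.inner, h]))]
  simp [actTapes, Bundle.map, Bundle.ofFun, Bundle.toFun, Bundle.work, Bundle.inner, Bundle.reg,
    Bundle.const, Post.apply]

theorem comp_step_copy_bit {b : Bool} (h : T.go.read = Symbol.bit b) :
    (comp M₁ M₂).step φ (compCfg (State.ctrl CompState.copy) T) =
      compCfg (State.ctrl CompState.copy)
        { T with
          go := T.go.act (T.go.read, Move.right)
          base := T.base.act (Symbol.bit b, Move.right) } := by
  rw [comp_step_ctrl (by
    simp only [compTrans]
    rw [show (T.map Tape.read).go = Symbol.bit b from h])]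
  simp [actTapes, Bundle.map, Bundle.ofFun, Bundle.toFun, Bundle.work, Bundle.inner, Bundle.reg,
    Bundle.const, Post.apply, h]

theorem comp_step_copy_stop (h : ∀ b, T.go.read ≠ Symbol.bit b) :
    (comp M₁ M₂).step φ (compCfg (State.ctrl CompState.copy) T) =
      compCfg (State.ctrl CompState.place)
        { T with
          go := { T.go with pos := 0 }
          base := { T.base with pos := 0 } } := by
  rw [comp_step_ctrl (by
    simp only [compTrans]
    split
    · next heq => exact absurd heq (h _)
    · rfl)]
  simp [actTapes, Bundle.map, Bundle.ofFun, Bundle.toFun, Bundle.work, Bundle.inner, Bundle.reg,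
    Bundle.const, Post.apply]

theorem comp_step_place_bit {b : Bool} (h : T.go.read = Symbol.bit b) (hd : T.disp.pos ≠ 0) :
    (comp M₁ M₂).step φ (compCfg (State.ctrl CompState.place) T) =
      compCfg (State.ctrl CompState.place)
        { T with
          go := T.go.act (T.go.read, Move.right)
          base := T.base.act (T.base.read, Move.right)
          cont := T.cont.act (Symbol.bit b, Move.right)
          disp := T.disp.act (T.disp.read, Move.left) } := by
  rw [comp_step_ctrl (by
    simp only [compTrans]
    rw [show (T.map Tape.read).go = Symbol.bit b from h,
      show decide ((T.work (Sum.inr (Sum.inr Reg.disp))).pos = 0) = false from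
        decide_eq_false hd])]
  simp [actTapes, Bundle.map, Bundle.ofFun, Bundle.toFun, Bundle.work, Bundle.inner, Bundle.reg,
    Bundle.const, Post.apply, h]

theorem comp_step_place_stop (h : (∀ b, T.go.read ≠ Symbol.bit b) ∨ T.disp.pos = 0) :
    (comp M₁ M₂).step φ (compCfg (State.ctrl CompState.place) T) =
      compCfg (CompState.ofOuter M₁.answer) T := by
  rw [comp_step_ctrl (by
    simp only [compTrans]
    split
    · next heq hd =>
      rcases h with h | h
      · exact absurd heq (h _)
      · exact absurd h (of_decide_eq_false hd)
    · rfl)]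
  simp [actTapes, Bundle.map, Bundle.ofFun, Bundle.toFun, Bundle.work, Bundle.inner, Bundle.reg,
    Bundle.const, Post.apply]

theorem comp_step_query :
    (comp M₁ M₂).step φ (compCfg State.query T) =
      compCfg (CompState.ofInner true M₂.answer)
        { T with qry := Tape.ofString (φ T.qry.content) T.qry.pos } := by
  refine congrArg (ResetTM.Cfg.mk _) (funext fun i => ?_)
  rcases i with _ | _ | _ | (_ | (_ | _ | _ | _) | (_ | _ | _ | _ | _)) <;> rfl

end OracleTM

theorem Tape.Spells.read_lt {Γ : Type} {t : Tape Γ} {w : List Bool} (h : t.Spells w) {i : ℕ}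
    (hi : i < w.length) (hp : t.pos = i) : t.read = Symbol.bit w[i] := by
  subst hp
  exact h.bit _ hi

theorem Tape.Spells.read_length {Γ : Type} {t : Tape Γ} {w : List Bool} (h : t.Spells w)
    (hp : t.pos = w.length) (b : Bool) : t.read ≠ Symbol.bit b := by
  rw [Tape.read, hp]
  exact h.not_bit b

/-! ### Running the inner machine and handing over its answer -/

namespace OracleTM

variable {M₁ M₂ : OracleTM} {φ : Baire} {T : CompTapes M₁ M₂}

/-- The tapes `T` agree with the tapes `ts` of the outer machine, except for the query tape. -/
def Frozen (T : CompTapes M₁ M₂) (ts : TapeId M₁.ι → Tape M₁.Γ) : Prop :=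
  T.inp = (ts TapeId.input).map Sum.inl ∧ T.out = (ts TapeId.output).map Sum.inl ∧
    ∀ k, T.f k = (ts (TapeId.work k)).map Sum.inl

/-- The outer machine is waiting for an answer, with head position `p` on the query tape. -/
def Waiting (T : CompTapes M₁ M₂) (p : ℕ) : Prop :=
  T.cont = Tape.ofString [] 0 ∧ T.disp.pos = p ∧ T.pos = Tape.ofString [] 0 ∧
    T.neg = Tape.ofString [] 0 ∧ T.base = Tape.ofString [] 0

/-- The goal is reached within `B` steps once the outer machine has received the answer `w`. -/
def Resumes (φ : Baire) (G : (comp M₁ M₂).Cfg → Prop) (ts : TapeId M₁.ι → Tape M₁.Γ)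
    (w : List Bool) (p B : ℕ) : Prop :=
  ∀ T : CompTapes M₁ M₂, Frozen T ts → T.qry.pos = 0 → T.cont.pos ≤ w.length →
    QueryRep T.reg (Tape.ofString w p) w p →
      ReachesIn ((comp M₁ M₂).step φ) G (compCfg (CompState.ofOuter M₁.answer) T) B

variable {G : (comp M₁ M₂).Cfg → Prop} {ts : TapeId M₁.ι → Tape M₁.Γ} {w : List Bool} {p B : ℕ}

/-- Each step trades one cell of displacement for one cell of `cont`, so their sum stays `p`, and
the loop ends when the answer or the displacement is used up. The cost is therefore bounded by the
length of the answer, independently of `p`. -/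
theorem reachesIn_place (hG : Resumes φ G ts w p B) (n i : ℕ) (T : CompTapes M₁ M₂)
    (hn : i + n = w.length) (hF : Frozen T ts) (hq : T.qry.pos = 0) (hgo : T.go.Spells w)
    (hgp : T.go.pos = i) (hb : T.base = Tape.ofString w i)
    (hc : T.cont = Tape.ofString (w.take i) i) (hd : i + T.disp.pos = p)
    (hpos : T.pos = Tape.ofString [] 0) (hneg : T.neg = Tape.ofString [] 0) :
    ReachesIn ((comp M₁ M₂).step φ) G (compCfg (State.ctrl CompState.place) T) (B + n + 1) := by
  induction n generalizing i T with
  | zero =>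
    refine ReachesIn.of_step ?_
    rw [comp_step_place_stop (Or.inl (hgo.read_length (by omega)))]
    refine hG T hF hq (by rw [hc]; exact hn.le) (QueryRep.of_answer ?_ ?_ ?_ ?_ hpos hneg)
    · simp only [Bundle.reg, hb, hc]
      rfl
    · simpa [Bundle.reg, hc] using hd
    · intro j _
      simp only [Bundle.reg, hc]
      rw [List.take_of_length_le (by omega)]
      rfl
    · intro _
      simp only [Bundle.reg, hc]
      exact hn
  | succ n ih =>
    have hi : i < w.length := by omega
    refine ReachesIn.of_step ?_
    by_cases hd0 : T.disp.pos = 0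
    · rw [comp_step_place_stop (Or.inr hd0)]
      refine (hG T hF hq (by rw [hc]; exact hi.le)
        (QueryRep.of_answer ?_ ?_ ?_ ?_ hpos hneg)).mono (by omega)
      · simp only [Bundle.reg, hb, hc]
        rfl
      · simpa [Bundle.reg, hc] using hd
      · intro j hj
        simp only [Bundle.reg, hc, Tape.ofString_pos] at hj ⊢
        simp [Tape.ofString, List.getElem?_take, hj]
      · intro h
        exact absurd hd0 (Nat.pos_iff_ne_zero.1 h)
    · rw [comp_step_place_bit (hgo.read_lt hi hgp) hd0]
      refine ReachesIn.mono (ih (i + 1) _ (by omega) hF hq (hgo.congr (by simp))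
        (by simp [hgp]) ?_ ?_ ?_ hpos hneg) (by omega)
      · simp only [hb, Tape.ofString_act_right]
      · simp only [hc, Tape.ofString_take_act w hi]
      · simp only [Tape.act_left_pos]
        omega

theorem reachesIn_copy (hG : Resumes φ G ts w p B) (n i : ℕ) (T : CompTapes M₁ M₂)
    (hn : i + n = w.length) (hF : Frozen T ts) (hq : T.qry.pos = 0) (hgo : T.go.Spells w)
    (hgp : T.go.pos = i) (hb : T.base = Tape.ofString (w.take i) i)
    (hc : T.cont = Tape.ofString [] 0) (hd : T.disp.pos = p)
    (hpos : T.pos = Tape.ofString [] 0) (hneg : T.neg = Tape.ofString [] 0) :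
    ReachesIn ((comp M₁ M₂).step φ) G (compCfg (State.ctrl CompState.copy) T)
      (B + w.length + n + 2) := by
  induction n generalizing i T with
  | zero =>
    refine ReachesIn.of_step ?_
    rw [comp_step_copy_stop (hgo.read_length (by omega))]
    refine reachesIn_place hG _ 0 _ (by simp) hF hq (hgo.congr rfl) rfl ?_ (by simpa using hc)
      (by simpa using hd) hpos hneg
    simp only [hb]
    rw [List.take_of_length_le (by omega)]
    rfl
  | succ n ih =>
    have hi : i < w.length := by omega
    refine ReachesIn.of_step ?_
    rw [comp_step_copy_bit (hgo.read_lt hi hgp)]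
    refine ReachesIn.mono (ih (i + 1) _ (by omega) hF hq (hgo.congr (by simp))
        (by simp [hgp]) ?_ hc hd hpos hneg) (by omega)
    simp only [hb, Tape.ofString_take_act w hi]

/-- Only work tapes report that their head is on the first cell. So the query tape is rewound in
lockstep with `gq`, whose head is at the same position. -/
theorem reachesIn_rewind (hG : Resumes φ G ts w p B) (n : ℕ) (T : CompTapes M₁ M₂)
    (hF : Frozen T ts) (hW : Waiting T p) (hq : T.qry.pos = n) (hgq : T.gq.pos = n)
    (hgo : T.go.Spells w) (hgp : T.go.pos = 0) :
    ReachesIn ((comp M₁ M₂).step φ) G (compCfg (State.ctrl CompState.rewind) T)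
      (B + 2 * w.length + n + 3) := by
  induction n generalizing T with
  | zero =>
    refine ReachesIn.of_step ?_
    rw [comp_step_rewind_zero hgq]
    obtain ⟨h1, h2, h3, h4, h5⟩ := hW
    exact ReachesIn.mono (reachesIn_copy hG w.length 0 _ (by simp) hF hq hgo hgp
      (by simpa using h5) h1 h2 h3 h4) (by omega)
  | succ n ih =>
    refine ReachesIn.of_step ?_
    rw [comp_step_rewind_pos (by omega)]
    exact ih _ hF hW (by simp [hq]) (by simp [hgq]) hgo hgp

theorem reachesIn_done (hG : Resumes φ G ts w p B) {n : ℕ} (hF : Frozen T ts) (hW : Waiting T p)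
    (hq : T.qry.pos = n) (hgq : T.gq.pos = n) (hgo : T.go.content = w) :
    ReachesIn ((comp M₁ M₂).step φ) G (compCfg (State.ctrl CompState.done) T)
      (B + 2 * w.length + n + 4) := by
  refine ReachesIn.of_step ?_
  rw [comp_step_done]
  refine reachesIn_rewind hG n _ hF hW hq hgq ?_ rfl
  exact (hgo ▸ T.go.spells_act_blank Move.stay).congr rfl

/-- The tapes `T` represent the tapes `us` of the inner machine. -/
structure InnerRep (asked : Bool) (T : CompTapes M₁ M₂) (us : TapeId M₂.ι → Tape M₂.Γ) :
    Prop where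
  gi : T.gi = (us TapeId.input).map innerSymbol
  go : T.go = (us TapeId.output).map innerSymbol
  gw : ∀ k, T.gw k = (us (TapeId.work k)).map innerSymbol
  qry_pos : T.qry.pos = (us TapeId.query).pos
  gq_pos : T.gq.pos = (us TapeId.query).pos
  qry_cells : ∀ i < (us TapeId.query).pos,
    T.qry.cells i = ((us TapeId.query).cells i).map innerSymbol
  query : (if asked then T.qry else T.gq) = (us TapeId.query).map innerSymbol

theorem InnerRep.read {asked : Bool} {us : TapeId M₂.ι → Tape M₂.Γ} (r : InnerRep asked T us) :
    M₁.innerRead M₂ asked (T.map Tape.read) = fun i => (us i).read := by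
  funext i
  cases i with
  | input =>
    change Symbol.unmap innerSymbol T.gi.read = _
    rw [r.gi, Tape.map_read, Symbol.unmap_map innerSymbol_injective]
  | output =>
    change Symbol.unmap innerSymbol T.go.read = _
    rw [r.go, Tape.map_read, Symbol.unmap_map innerSymbol_injective]
  | query =>
    have h := r.query
    change Symbol.unmap innerSymbol (if asked then T.qry.read else T.gq.read) = _
    rw [← apply_ite Tape.read, h, Tape.map_read, Symbol.unmap_map innerSymbol_injective]
  | work k =>
    change Symbol.unmap innerSymbol (T.gw k).read = _
    rw [r.gw, Tape.map_read, Symbol.unmap_map innerSymbol_injective]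

/-- The tapes after an action of the inner machine. -/
def innerAct (T : CompTapes M₁ M₂) (a : TapeId M₂.ι → Symbol M₂.Γ × Move) : CompTapes M₁ M₂ :=
  { T with
    qry := T.qry.act (mapAct innerSymbol (a TapeId.query))
    gi := T.gi.act (mapAct innerSymbol (a TapeId.input))
    go := T.go.act (mapAct innerSymbol (a TapeId.output))
    gq := T.gq.act (mapAct innerSymbol (a TapeId.query))
    gw := fun k => (T.gw k).act (mapAct innerSymbol (a (TapeId.work k))) }

theorem comp_step_inner {asked : Bool} {us : TapeId M₂.ι → Tape M₂.Γ} (r : InnerRep asked T us)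
    (q : M₂.Q) :
    (comp M₁ M₂).step φ (compCfg (State.ctrl (CompState.inner q asked)) T) =
      compCfg (CompState.ofInner asked (M₂.trans q fun i => (us i).read).1)
        (innerAct T (M₂.trans q fun i => (us i).read).2) := by
  rw [comp_step_ctrl (by
    simp only [compTrans, r.read]
    rfl)]
  simp [actTapes, innerAct, Bundle.map, Bundle.ofFun, Bundle.toFun, Bundle.work, Bundle.inner,
    Bundle.reg, Bundle.const, Post.apply]

/-- Before the first query, remnants of earlier runs may remain on the real query tape at or right
of the head. A right move only uncovers a cell that has just been written, so the part left of the
head stays reliable. -/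
theorem InnerRep.act {asked : Bool} {us : TapeId M₂.ι → Tape M₂.Γ} (r : InnerRep asked T us)
    (a : TapeId M₂.ι → Symbol M₂.Γ × Move) :
    InnerRep asked (innerAct T a) (fun i => (us i).act (a i)) := by
  obtain ⟨h1, h2, h3, h4, h5, h6, h7⟩ := r
  refine ⟨?_, ?_, fun k => ?_, ?_, ?_, fun i hi => ?_, ?_⟩
  · simp only [innerAct, mapAct, h1, Tape.map_act]
  · simp only [innerAct, mapAct, h2, Tape.map_act]
  · simp only [innerAct, mapAct, h3, Tape.map_act]
  · simp only [innerAct, mapAct, Tape.act_pos, h4]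
    exact (Tape.act_pos _ _ _).symm
  · simp only [innerAct, mapAct, Tape.act_pos, h5]
    exact (Tape.act_pos _ _ _).symm
  · have := (us TapeId.query).act_pos_le (a TapeId.query)
    simp only [innerAct, mapAct, Tape.act_cells, h4]
    split_ifs with hj
    · rfl
    · exact h6 i (by omega)
  · cases asked <;> simp only [innerAct, mapAct, Bool.false_eq_true, if_false, if_true] at h7 ⊢ <;>
      rw [h7, Tape.map_act]

/-- For a query the cells left of the head suffice. The answer then replaces the whole tape, so the
real query tape becomes exact and the flag may be set. The term `3 * K` pays for the handover:
rewinding the query tape, copying the answer to `base`, and placing it on `cont`. -/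
theorem reachesIn_inner (hG : Resumes φ G ts w p B) {K : ℕ} (r : ℕ) (asked : Bool)
    (T : CompTapes M₁ M₂) (d : M₂.Cfg) (hF : Frozen T ts) (hW : Waiting T p)
    (hI : InnerRep asked T d.tapes) (hq : (d.tapes TapeId.query).pos + r ≤ K)
    (hd : M₂.Outputs w ((M₂.step φ)^[r] d)) (hw : w.length ≤ K) :
    ReachesIn ((comp M₁ M₂).step φ) G (compCfg (CompState.ofInner asked d.state) T)
      (B + 3 * K + r + 4) := by
  induction r generalizing asked T d with
  | zero =>
    have h1 : d.state = State.halt := hd.1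
    have h2 : T.go.content = w := by
      rw [hI.go, Tape.content_map]
      exact hd.2
    rw [h1]
    exact (reachesIn_done hG hF hW (hI.qry_pos.trans rfl) hI.gq_pos h2).mono (by omega)
  | succ r ih =>
    rw [Function.iterate_succ_apply] at hd
    cases hds : d.state with
    | halt =>
      have e : M₂.step φ d = d := by simp [step, hds]
      rw [e] at hd
      have := ih asked T d hF hW hI (by omega) hd
      rw [hds] at this
      exact this.mono (by omega)
    | query =>
      refine ReachesIn.mono (B := B + 3 * K + r + 4 + 1) (ReachesIn.of_step ?_) (by omega)
      have hc : T.qry.content = (d.tapes TapeId.query).content := by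
        rw [← Tape.content_map (innerSymbol : M₂.Γ → CompSymbol M₁.Γ M₂.Γ)]
        exact Tape.content_congr hI.qry_pos hI.qry_cells
      have hds' : (M₂.step φ d).state = M₂.answer := by simp [step, hds]
      have key := ih true { T with qry := Tape.ofString (φ T.qry.content) T.qry.pos }
        (M₂.step φ d) hF hW ?_ ?_ hd
      · rw [hds'] at key
        exact comp_step_query ▸ key
      · obtain ⟨h1, h2, h3, h4, h5, -, -⟩ := hI
        refine ⟨?_, ?_, ?_, ?_, ?_, ?_, ?_⟩ <;> simp [step, *]
        intro i _
        rw [← Tape.map_cells, Tape.map_ofString]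
      · simp only [step, hds, Tape.ofString_pos]
        omega
    | ctrl q =>
      refine ReachesIn.mono (B := B + 3 * K + r + 4 + 1) (ReachesIn.of_step ?_) (by omega)
      have hstep : M₂.step φ d = ⟨(M₂.trans q fun i => (d.tapes i).read).1, fun i =>
          (d.tapes i).act ((M₂.trans q fun i => (d.tapes i).read).2 i)⟩ := by simp [step, hds]
      rw [hstep] at hd
      rw [CompState.ofInner, comp_step_inner hI]
      refine ih asked (innerAct T _) ⟨_, _⟩ hF hW (hI.act _) ?_ hd
      have := (d.tapes TapeId.query).act_pos_le
        ((M₂.trans q fun i => (d.tapes i).read).2 TapeId.query)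
      exact (Nat.add_le_add_right this r).trans (by omega)

end OracleTM

/-! ### Loading a query and running the outer machine -/

namespace OracleTM

variable {M₁ M₂ : OracleTM} {φ : Baire}

theorem step_pos_le (M : OracleTM) (φ : Baire) (c : M.Cfg) (i : TapeId M.ι) :
    ((M.step φ c).tapes i).pos ≤ (c.tapes i).pos + 1 := by
  unfold step
  split
  · exact Nat.le_succ _
  · cases i <;> exact Nat.le_succ _
  · exact Tape.act_pos_le _ _

/-- Since no head moves in an oracle step, this holds however long the oracle answers are. Via
`Tape.length_content_le` it bounds outputs by the running time. -/
theorem run_pos_le (M : OracleTM) (φ : Baire) (a : List Bool) (t : ℕ) (i : TapeId M.ι) :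
    ((M.run φ a t).tapes i).pos ≤ t := by
  induction t with
  | zero => cases i <;> exact le_rfl
  | succ t ih =>
    rw [run, Function.iterate_succ_apply']
    exact (M.step_pos_le φ _ i).trans (Nat.succ_le_succ ih)

variable {G : (comp M₁ M₂).Cfg → Prop} {ts : TapeId M₁.ι → Tape M₁.Γ} {b w : List Bool}
  {p B K : ℕ}

theorem reachesIn_load (hG : Resumes φ G ts w p B) (hw : M₂.Outputs w (M₂.run φ b K))
    (n i : ℕ) (T : CompTapes M₁ M₂) (hn : i + n = b.length) (hF : Frozen T ts)
    (hb : T.cont.Spells b) (hcp : T.cont.pos = i) (hq : T.qry.pos = 0)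
    (hgi : T.gi = Tape.ofString (b.take i) i) (hgo : T.go = Tape.ofString [] 0)
    (hgq : T.gq = Tape.ofString [] 0) (hgw : ∀ k, T.gw k = Tape.ofString [] 0)
    (hd : T.disp.pos = p) (hpos : T.pos = Tape.ofString [] 0)
    (hneg : T.neg = Tape.ofString [] 0) (hbase : T.base = Tape.ofString [] 0) :
    ReachesIn ((comp M₁ M₂).step φ) G (compCfg (State.ctrl CompState.load) T)
      (B + 4 * K + n + 5) := by
  induction n generalizing i T with
  | zero =>
    refine ReachesIn.of_step ?_
    rw [comp_step_load_stop (hb.read_length (by omega))]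
    have hle : w.length ≤ K := by
      rw [← hw.2]
      exact (Tape.length_content_le _).trans (M₂.run_pos_le φ b K _)
    refine ReachesIn.mono (reachesIn_inner hG K false _ (M₂.init b) hF
      ⟨rfl, hd, hpos, hneg, hbase⟩ ?_ ?_ hw hle) (by omega)
    · refine ⟨?_, ?_, fun k => ?_, hq, ?_, ?_, ?_⟩
      · simp only [hgi, init, Tape.map_ofString]
        rw [List.take_of_length_le (by omega)]
        rfl
      · simp only [hgo, init, Tape.map_ofString]
      · simp only [hgw, init, Tape.map_ofString]
      · simp only [hgq, init]
        rfl
      · intro j hj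
        exact absurd hj (Nat.not_lt_zero j)
      · simp [hgq, init]
    · simp [init]
  | succ n ih =>
    have hi : i < b.length := by omega
    refine ReachesIn.of_step ?_
    rw [comp_step_load_bit (hb.read_lt hi hcp)]
    refine ReachesIn.mono (ih (i + 1) _ (by omega) hF (hb.congr (by simp)) (by simp [hcp]) hq
      ?_ hgo hgq hgw hd hpos hneg hbase) (by omega)
    simp only [hgi, Tape.ofString_take_act b hi]

theorem reachesIn_back (hG : Resumes φ G ts w p B) (hw : M₂.Outputs w (M₂.run φ b K))
    (n : ℕ) (T : CompTapes M₁ M₂) (hF : Frozen T ts)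
    (hb : T.cont.Spells b) (hcp : T.cont.pos = n) (hq : T.qry.pos = 0)
    (hgi : T.gi = Tape.ofString [] 0) (hgo : T.go = Tape.ofString [] 0)
    (hgq : T.gq = Tape.ofString [] 0) (hgw : ∀ k, T.gw k = Tape.ofString [] 0)
    (hd : n + T.disp.pos = p) (hpos : T.pos = Tape.ofString [] 0)
    (hneg : T.neg = Tape.ofString [] 0) (hbase : T.base = Tape.ofString [] 0) :
    ReachesIn ((comp M₁ M₂).step φ) G (compCfg (State.ctrl CompState.back) T)
      (B + 4 * K + b.length + n + 6) := by
  induction n generalizing T with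
  | zero =>
    refine ReachesIn.of_step ?_
    rw [comp_step_back_zero hcp]
    exact ReachesIn.mono (reachesIn_load hG hw b.length 0 T (by simp) hF hb hcp hq
      (by simpa using hgi) hgo hgq hgw (by simpa using hd) hpos hneg hbase) (by omega)
  | succ n ih =>
    refine ReachesIn.of_step ?_
    rw [comp_step_back_pos (by omega)]
    refine ReachesIn.mono (ih _ hF (hb.congr (by simp)) (by simp [hcp]) hq hgi hgo hgq hgw ?_
      hpos hneg hbase) (by omega)
    simp only [Tape.act_right_pos]
    omega

/-- The inner run takes `K` steps and the handover `3 * K`. The head of `cont` is moved back once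
and then passes over the query once, whence `2 * T.cont.pos`. The true head position `p` does not
enter. -/
theorem reachesIn_ask (hG : Resumes φ G ts w p B) {T : CompTapes M₁ M₂}
    (hw : M₂.Outputs w (M₂.run φ T.cont.content K)) (hF : Frozen T ts) (hq : T.qry.pos = 0)
    (hd : T.cont.pos + T.disp.pos = p) :
    ReachesIn ((comp M₁ M₂).step φ) G (compCfg (State.ctrl CompState.ask) T)
      (B + 4 * K + 2 * T.cont.pos + 7) := by
  have := T.cont.length_content_le
  refine ReachesIn.mono (ReachesIn.of_step (B := B + 4 * K + T.cont.content.length +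
    T.cont.pos + 6) ?_) (by omega)
  rw [comp_step_ask]
  exact reachesIn_back hG hw T.cont.pos _ hF (T.cont.spells_act_blank _) rfl hq rfl rfl rfl
    (fun _ => rfl) hd rfl rfl rfl

/-- The tapes after an action of the outer machine. -/
noncomputable def outerAct (T : CompTapes M₁ M₂) (a : TapeId M₁.ι → Symbol M₁.Γ × Move) :
    CompTapes M₁ M₂ :=
  let x := queryAct (fun r => (T.reg r).read) (zeros T.reg) (a TapeId.query)
  { T with
    inp := T.inp.act (mapAct Sum.inl (a TapeId.input))
    out := T.out.act (mapAct Sum.inl (a TapeId.output))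
    f := fun k => (T.f k).act (mapAct Sum.inl (a (TapeId.work k)))
    cont := T.cont.act (x Reg.cont)
    disp := T.disp.act (x Reg.disp)
    pos := T.pos.act (x Reg.pos)
    neg := T.neg.act (x Reg.neg)
    base := T.base.act (x Reg.base) }

theorem outerRead_eq {T : CompTapes M₁ M₂} {p₀ : ℕ} (hF : Frozen T ts)
    (hX : QueryRep T.reg (ts TapeId.query) w p₀) :
    M₁.outerRead M₂ (T.map Tape.read) (fun r => decide ((T.reg r).pos = 0)) =
      fun i => (ts i).read := by
  obtain ⟨h1, h2, h3⟩ := hF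
  funext i
  cases i with
  | input =>
    change Symbol.unmap Sum.inl T.inp.read = _
    rw [h1, Tape.map_read, Symbol.unmap_map Sum.inl_injective]
  | output =>
    change Symbol.unmap Sum.inl T.out.read = _
    rw [h2, Tape.map_read, Symbol.unmap_map Sum.inl_injective]
  | query => exact hX.read
  | work k =>
    change Symbol.unmap Sum.inl (T.f k).read = _
    rw [h3, Tape.map_read, Symbol.unmap_map Sum.inl_injective]

theorem reg_map_read (T : CompTapes M₁ M₂) :
    (T.map Tape.read).reg = fun r => (T.reg r).read := by
  funext r
  cases r <;> rfl

theorem comp_step_outer {T : CompTapes M₁ M₂} {p₀ : ℕ} (hF : Frozen T ts)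
    (hX : QueryRep T.reg (ts TapeId.query) w p₀) (q : M₁.Q) :
    (comp M₁ M₂).step φ (compCfg (State.ctrl (CompState.outer q)) T) =
      compCfg (CompState.ofOuter (M₁.trans q fun i => (ts i).read).1)
        (outerAct T (M₁.trans q fun i => (ts i).read).2) := by
  rw [comp_step_ctrl (by
    simp only [compTrans, reg_map_read]
    rw [show M₁.outerRead M₂ (T.map Tape.read)
      (fun r => decide ((T.work (Sum.inr (Sum.inr r))).pos = 0)) = _ from outerRead_eq hF hX])]
  simp only [actTapes, outerAct, Bundle.map, Bundle.ofFun, Bundle.toFun, Bundle.work,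
    Bundle.inner, Bundle.const, Post.apply, Tape.act_read_stay]
  rfl

/-- Here `2 * T.cont.pos` is a potential. An ordinary step raises it by at most `2`. A query
consumes it, costs `4 * K + 7` more, and leaves at most `2 * K`, because `cont` then ends no further
than the answer; this gives `6 * K + 8` for each step. The invariant on the query head and the
remaining steps keeps all queries within length `L`. -/
theorem reachesIn_outer {ψ : Baire} {v : List Bool} {L : ℕ}
    (hM : ∀ b : List Bool, b.length ≤ L → M₂.Outputs (ψ b) (M₂.run φ b K))
    (r : ℕ) (T : CompTapes M₁ M₂) (d : M₁.Cfg) {w : List Bool} {p₀ : ℕ}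
    (hF : Frozen T d.tapes) (hq : T.qry.pos = 0)
    (hX : QueryRep T.reg (d.tapes TapeId.query) w p₀)
    (hL : (d.tapes TapeId.query).pos + r ≤ L)
    (hd : M₁.Outputs v ((M₁.step ψ)^[r] d)) :
    ReachesIn ((comp M₁ M₂).step φ) ((comp M₁ M₂).Outputs v)
      (compCfg (CompState.ofOuter d.state) T) ((6 * K + 8) * r + 2 * T.cont.pos) := by
  induction r generalizing T d w p₀ with
  | zero =>
    refine ReachesIn.of_holds ⟨?_, ?_⟩
    · rw [show d.state = State.halt from hd.1]
      rfl
    · change T.out.content = v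
      rw [hF.2.1, Tape.content_map]
      exact hd.2
  | succ r ih =>
    rw [Function.iterate_succ_apply] at hd
    cases hds : d.state with
    | halt =>
      have e : M₁.step ψ d = d := by simp [step, hds]
      rw [e] at hd
      have := ih T d hF hq hX (by omega) hd
      rw [hds] at this
      exact this.mono (by rw [mul_add]; omega)
    | query =>
      have hb : T.cont.content = (d.tapes TapeId.query).content := hX.content
      have hbl : T.cont.content.length ≤ L := by
        have := (d.tapes TapeId.query).length_content_le
        rw [hb]
        omega
      have hw := hM _ hbl
      have hwl : (ψ T.cont.content).length ≤ K := by
        rw [← hw.2]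
        exact (Tape.length_content_le _).trans (M₂.run_pos_le φ _ K _)
      refine (reachesIn_ask (p := (d.tapes TapeId.query).pos) (B := (6 * K + 8) * r + 2 * K)
        (ts := d.tapes) ?_ hw hF hq hX.pos_add).mono (by rw [mul_add]; omega)
      intro T' hF' hq' hc' hX'
      have hds' : (M₁.step ψ d).state = M₁.answer := by simp [step, hds]
      rw [← hds']
      refine (ih T' _ ?_ hq' (w := ψ T.cont.content) (p₀ := (d.tapes TapeId.query).pos) ?_ ?_
        hd).mono (by omega)
      · obtain ⟨h1, h2, h3⟩ := hF'
        refine ⟨?_, ?_, fun k => ?_⟩ <;> simp [step, *]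
      · simpa [step, hds, hb] using hX'
      · simp only [step, hds, Tape.ofString_pos]
        omega
    | ctrl q =>
      have hstep : M₁.step ψ d = ⟨(M₁.trans q fun i => (d.tapes i).read).1, fun i =>
          (d.tapes i).act ((M₁.trans q fun i => (d.tapes i).read).2 i)⟩ := by simp [step, hds]
      rw [hstep] at hd
      set a := (M₁.trans q fun i => (d.tapes i).read).2 with ha
      have hc : (outerAct T a).cont.pos ≤ T.cont.pos + 1 := Tape.act_pos_le _ _
      refine ReachesIn.mono (B := (6 * K + 8) * r + 2 * (outerAct T a).cont.pos + 1)
        (ReachesIn.of_step ?_) (by rw [mul_add]; omega)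
      rw [CompState.ofOuter, comp_step_outer hF hX]
      refine ih (outerAct T a) ⟨_, _⟩ ?_ hq (w := w) (p₀ := p₀) ?_ ?_ hd
      · obtain ⟨h1, h2, h3⟩ := hF
        refine ⟨?_, ?_, fun k => ?_⟩
        · simp only [outerAct, mapAct, h1, Tape.map_act]
        · simp only [outerAct, mapAct, h2, Tape.map_act]
        · simp only [outerAct, mapAct, h3, Tape.map_act]
      · have e : (outerAct T a).reg = fun r => (T.reg r).act
            (queryAct (fun r => (T.reg r).read) (zeros T.reg) (a TapeId.query) r) := by
          funext r
          cases r <;> rfl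
        rw [e]
        exact hX.act _
      · have := (d.tapes TapeId.query).act_pos_le (a TapeId.query)
        exact (Nat.add_le_add_right this r).trans (by omega)

theorem reachesIn_comp {ψ : Baire} {a v : List Bool} {L : ℕ}
    (hM : ∀ b : List Bool, b.length ≤ L → M₂.Outputs (ψ b) (M₂.run φ b K))
    (hv : M₁.Outputs v (M₁.run ψ a L)) :
    ReachesIn ((comp M₁ M₂).step φ) ((comp M₁ M₂).Outputs v) ((comp M₁ M₂).init a)
      ((6 * K + 8) * L) := by
  have e : (comp M₁ M₂).init a = compCfg (CompState.ofOuter M₁.start)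
      { (Bundle.const (Tape.ofString [] 0) : CompTapes M₁ M₂) with inp := Tape.ofString a 0 } := by
    refine congrArg (ResetTM.Cfg.mk _) (funext fun i => ?_)
    rcases i with _ | _ | _ | (_ | (_ | _ | _ | _) | (_ | _ | _ | _ | _)) <;> rfl
  rw [e]
  refine (reachesIn_outer hM L _ (M₁.init a) (w := []) (p₀ := 0) ?_ rfl ?_ ?_ hv).mono le_rfl
  · refine ⟨?_, ?_, fun k => ?_⟩ <;>
      simp [init, Bundle.const, Bundle.ofFun]
  · change QueryRep _ (Tape.ofString [] 0) _ _
    exact QueryRep.of_answer rfl rfl (fun i hi => absurd hi (Nat.not_lt_zero i)) (fun _ => rfl)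
      rfl rfl
  · simp [init]

end OracleTM

/-! ### Size functions and running times -/

theorem length_le_size (φ : Baire) {a : List Bool} {n : ℕ} (h : a.length ≤ n) :
    (φ a).length ≤ size φ n := by
  unfold size
  refine le_trans ?_ (Finset.le_sup (Finset.mem_range.2 (Nat.lt_succ_of_le h)))
  exact Finset.le_sup (f := fun v : List.Vector Bool a.length => (φ v.toList).length)
    (Finset.mem_univ ⟨a, rfl⟩)

theorem size_le {φ : Baire} {n m : ℕ} (h : ∀ a : List Bool, a.length ≤ n → (φ a).length ≤ m) :
    size φ n ≤ m := by
  refine Finset.sup_le fun k hk => Finset.sup_le fun v _ => h _ ?_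
  rw [v.toList_length]
  exact Nat.lt_succ_iff.1 (Finset.mem_range.1 hk)

theorem monotone_size (φ : Baire) : Monotone (size φ) := fun _ _ h =>
  size_le fun _ ha => length_le_size φ (ha.trans h)

theorem IsRunningTime.monotone {T : (ℕ → ℕ) → ℕ → ℕ} (h : IsRunningTime T) {l : ℕ → ℕ}
    (hl : Monotone l) : Monotone (T l) := (h l l hl hl le_rfl).1

/-- `S` sends monotone functions to monotone functions and preserves their order, so the conditions
on `T` apply to `S l` and `S l'`. -/
theorem IsRunningTime.comp {T S : (ℕ → ℕ) → ℕ → ℕ} (hT : IsRunningTime T) (hS : IsRunningTime S)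
    (C : ℕ) : IsRunningTime fun l n =>
      C * (T (S l) n + S l (T (S l) n) * T (S l) n) := by
  have hmono : ∀ l : ℕ → ℕ, Monotone l → Monotone fun n =>
      C * (T (S l) n + S l (T (S l) n) * T (S l) n) := by
    intro l hl n m hnm
    have h1 := hT.monotone (hS.monotone hl) hnm
    have h2 := hS.monotone hl h1
    simp only
    gcongr
  intro l l' hl hl' hle
  refine ⟨hmono l hl, hmono l' hl', fun n => ?_⟩
  have h1 : T (S l') n ≤ T (S l) n :=
    (hT _ _ (hS.monotone hl) (hS.monotone hl') (hS _ _ hl hl' hle).2.2).2.2 n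
  have h2 : S l' (T (S l') n) ≤ S l (T (S l) n) :=
    (hS.monotone hl' h1).trans ((hS _ _ hl hl' hle).2.2 _)
  simp only
  gcongr

/-! ### Halted runs and the time bound for the composition -/

namespace OracleTM

variable {M : OracleTM} {φ : Baire} {a : List Bool}

theorem run_eq_of_halted {t t' : ℕ} (h : M.HaltsWithin φ a t) (hle : t ≤ t') :
    M.run φ a t' = M.run φ a t := by
  induction t', hle using Nat.le_induction with
  | base => rfl
  | succ t' _ ih =>
    rw [run, Function.iterate_succ_apply']
    change M.step φ (M.run φ a t') = _
    rw [ih]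
    unfold HaltsWithin at h
    simp [step, h]

theorem Computes.outputs {F : Baire → Baire} (hF : M.Computes F) {t t' : ℕ}
    (h : M.HaltsWithin φ a t) (hle : t ≤ t') : M.Outputs (F φ a) (M.run φ a t') := by
  obtain ⟨s, hs, hout⟩ := hF φ a
  have e : M.run φ a t' = M.run φ a s := by
    rw [run_eq_of_halted h hle, ← run_eq_of_halted h (le_max_left t s),
      run_eq_of_halted hs (le_max_right t s)]
  rw [e]
  exact ⟨hs, hout⟩

theorem computableInTime_of_reachesIn {F : Baire → Baire} {T : (ℕ → ℕ) → ℕ → ℕ}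
    (hT : IsRunningTime T)
    (h : ∀ φ a, ReachesIn (M.step φ) (M.Outputs (F φ a)) (M.init a) (T (size φ) a.length)) :
    ComputableInTime F T := by
  refine ⟨M, fun φ a => ?_, hT, fun φ a => ?_⟩
  · obtain ⟨t, -, ht⟩ := h φ a
    exact ⟨t, ht⟩
  · obtain ⟨t, hle, ht⟩ := h φ a
    have e : M.run φ a (T (size φ) a.length) = M.run φ a t := run_eq_of_halted ht.1 hle
    rw [HaltsWithin, e]
    exact ht.1

end OracleTM

theorem ComputableInTime.comp {F G : Baire → Baire} {T S : (ℕ → ℕ) → ℕ → ℕ}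
    (hF : ComputableInTime F T) (hG : ComputableInTime G S) :
    ∃ C : ℕ, ComputableInTime (F ∘ G) fun l n =>
      C * (T (S l) n + S l (T (S l) n) * T (S l) n) := by
  obtain ⟨M₁, hF, hT, hM₁⟩ := hF
  obtain ⟨M₂, hG, hS, hM₂⟩ := hG
  -- If `M₁` starts halted, `T` may vanish and leave no time even for the setup step. But then the
  -- oracle plays no role, and `M₁` itself computes `F ∘ G` in zero steps, so `C = 0` works.
  by_cases hstart : M₁.start = State.halt
  · refine ⟨0, OracleTM.computableInTime_of_reachesIn (M := M₁) (hT.comp hS 0) fun φ a => ?_⟩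
    have h0 : ∀ ψ, M₁.HaltsWithin ψ a 0 := fun ψ => hstart
    exact ReachesIn.of_holds (hF.outputs (h0 (G φ)) le_rfl)
  · obtain ⟨M, C, hM⟩ := (OracleTM.comp M₁ M₂).exists_oracleTM
    refine ⟨9 * C, OracleTM.computableInTime_of_reachesIn (M := M) (hT.comp hS _) fun φ a => ?_⟩
    have hmS : Monotone (S (size φ)) := hS.monotone (monotone_size φ)
    -- The values of `G φ` are no longer than the time taken to write them. So the time bound of
    -- `M₁` with oracle `G φ` can be expressed through `S (size φ)`.
    have hsize : size (G φ) ≤ S (size φ) := fun n => size_le fun b hb => by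
      have h := (hG.outputs (hM₂ φ b) le_rfl).2
      rw [← h]
      exact (Tape.length_content_le _).trans ((M₂.run_pos_le φ b _ _).trans (hmS hb))
    set L := T (S (size φ)) a.length with hL
    set K := S (size φ) L with hK
    have hhalt : T (size (G φ)) a.length ≤ L :=
      (hT _ _ hmS (monotone_size _) hsize).2.2 a.length
    have hv : M₁.Outputs (F (G φ) a) (M₁.run (G φ) a L) := hF.outputs (hM₁ (G φ) a) hhalt
    have hq : ∀ b : List Bool, b.length ≤ L → M₂.Outputs (G φ b) (M₂.run φ b K) :=
      fun b hb => hG.outputs (hM₂ φ b) (hmS hb)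
    -- Needed to absorb the additive constant of the simulation: `8 * L + 1 ≤ 9 * L`.
    have hpos : 1 ≤ L := by
      by_contra h0
      have := hv.1
      rw [show L = 0 by omega] at this
      exact hstart this
    refine (hM φ a _ _ (OracleTM.reachesIn_comp hq hv)).mono ?_
    calc C * ((6 * K + 8) * L + 1) ≤ C * (9 * (L + K * L)) :=
          Nat.mul_le_mul_left _ (by nlinarith [Nat.zero_le (K * L)])
      _ = 9 * C * (L + K * L) := by ring

/-! ### Second-order polynomials -/

namespace IsSecondOrderPoly

variable {P R : (ℕ → ℕ) → ℕ → ℕ}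

theorem const (k : ℕ) : IsSecondOrderPoly fun _ _ => k := by
  simpa using poly (Polynomial.C k)

theorem pow (hP : IsSecondOrderPoly P) (k : ℕ) : IsSecondOrderPoly fun l n => P l n ^ k := by
  induction k with
  | zero => simpa using const 1
  | succ k ih => simpa only [pow_succ] using ih.mul hP

theorem eval (hP : IsSecondOrderPoly P) (p : Polynomial ℕ) :
    IsSecondOrderPoly fun l n => p.eval (P l n) := by
  induction p using Polynomial.induction_on' with
  | add p q hp hq => simpa only [Polynomial.eval_add] using hp.add hq
  | monomial k c => simpa only [Polynomial.eval_monomial] using (const c).mul (hP.pow k)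

theorem subst_arg (hR : IsSecondOrderPoly R) (hP : IsSecondOrderPoly P) :
    IsSecondOrderPoly fun l n => R l (P l n) := by
  induction hR with
  | poly p => exact hP.eval p
  | add _ _ h1 h2 => exact h1.add h2
  | mul _ _ h1 h2 => exact h1.mul h2
  | app _ h => exact h.app

/-- Under the substitution an application of `l` becomes an application of `R l`, that is, a
substitution into the number argument of `R`; hence `subst_arg` comes first. -/
theorem subst_fun (hP : IsSecondOrderPoly P) (hR : IsSecondOrderPoly R) :
    IsSecondOrderPoly fun l n => P (R l) n := by
  induction hP with
  | poly p => exact poly p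
  | add _ _ h1 h2 => exact h1.add h2
  | mul _ _ h1 h2 => exact h1.mul h2
  | app _ h => exact hR.subst_arg h

end IsSecondOrderPoly

theorem PolyTimeComputable.comp {F G : Baire → Baire} (hF : PolyTimeComputable F)
    (hG : PolyTimeComputable G) : PolyTimeComputable (F ∘ G) := by
  obtain ⟨T, hT, hF⟩ := hF
  obtain ⟨S, hS, hG⟩ := hG
  obtain ⟨C, hC⟩ := hF.comp hG
  have hTS := hT.subst_fun hS
  exact ⟨_, (IsSecondOrderPoly.const C).mul (hTS.add ((hS.subst_arg hTS).mul hTS)), hC⟩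

end SecondOrder

theorem mainTheorem7 :
    (∀ (F G : SecondOrder.Baire → SecondOrder.Baire) (T S : (ℕ → ℕ) → ℕ → ℕ),
      SecondOrder.ComputableInTime F T → SecondOrder.ComputableInTime G S →
        ∃ C : ℕ, SecondOrder.ComputableInTime (F ∘ G) fun l n =>
          C * (T (S l) n + S l (T (S l) n) * T (S l) n)) ∧
    (∀ F G : SecondOrder.Baire → SecondOrder.Baire,
      SecondOrder.PolyTimeComputable F → SecondOrder.PolyTimeComputable G →
        SecondOrder.PolyTimeComputable (F ∘ G)) :=
  ⟨fun _ _ _ _ hF hG => hF.comp hG, fun _ _ hF hG => hF.comp hG⟩
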